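/- Let $\mathcal L\subset\mathbb R^2$ be a lattice with basis $v^{(1)},v^{(2)}$ and let $\Omega$ be a (measurable) fundamental domain of $\mathcal L$, of area $1$. Let $\mathbf A_0(x,y)=\pi(-y,x)$, $\operatorname{curl}\mathbf a=\partial_x a_y-\partial_y a_x$, and let $\mathcal A$ be the set of pairs $(u,\mathbf a)$ such that * $u\in H^1_{loc}(\mathbb R^2;\mathbb C)$ and, for $v=v^{(1)}$ and $v=v^{(2)}$, $u((x,y)+v)=e^{i\pi(v_xy-v_yx)}u(x,y)$ for almost every $(x,y)\in\mathbb R^2$; * $\mathbf a\in H^1_{loc}(\mathbb R^2;\mathbb R^2)$ is $\mathcal L$-periodic, $\operatorname{div}\mathbf a=0$ and $\int_\Omega\mathbf a=0$. All derivatives are weak derivatives. Let $k=\frac1{\sqrt2}$, $H_{int}\in\mathbb R$ and $\mu=\frac{H_{int}}{2\pi k}$. For $(u,\mathbf a)\in\mathcal A$ put $\mathbf C=\mathbf A_0+\mathbf a$, $D_+u=\partial_xu+i\,\partial_yu+(C_y-iC_x)u$, $$E_{k,H_{int}}(u,\mathbf a)=\int_\Omega\frac\mu2\|i\nabla u+\mathbf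 C u\|^2+\frac14(1-|u|^2)^2+\frac{\mu^2k^2}{2}|\operatorname{curl}\mathbf a|^2,$$ $$A_{+,H_{int}}(u,\mathbf a)=\int_\Omega\frac\mu2|D_+u|^2+\frac14\bigl|\mu\operatorname{curl}\mathbf C-(1-|u|^2)\bigr|^2 .$$ Then for every $(u,\mathbf a)\in\mathcal A$ both integrands are integrable on $\Omega$, and $$E_{\frac1{\sqrt2},H_{int}}(u,\mathbf a)=\mu\pi-(\mu\pi)^2+A_{+,H_{int}}(u,\mathbf a).$$ -/

import Mathlib

open MeasureTheory

noncomputable section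

namespace GinzburgLandau

/-- The Euclidean plane `ℝ²`; for `z : Plane`, `z 0` is the coordinate `x` and `z 1` is `y`. -/
abbrev Plane : Type := EuclideanSpace ℝ (Fin 2)

section Sobolev

variable {F : Type*} [NormedAddCommGroup F] [NormedSpace ℝ F]

/-- `f` is locally square integrable on the plane. -/
def MemL2loc (f : Plane → F) : Prop :=
  ∀ K : Set Plane, IsCompact K → MemLp f 2 (volume.restrict K)

/-- `g` is the weak (distributional) partial derivative of `f` in the `i`-th coordinate. -/
def IsWeakPartial (i : Fin 2) (f g : Plane → F) : Prop :=
  LocallyIntegrable f volume ∧ LocallyIntegrable g volume ∧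
    ∀ φ : Plane → ℝ, ContDiff ℝ (⊤ : ℕ∞) φ → HasCompactSupport φ →
      ∫ z, fderiv ℝ φ z (EuclideanSpace.single i 1) • f z = - ∫ z, φ z • g z

/-- The Sobolev space `H¹_loc` of the plane. -/
def MemH1loc (f : Plane → F) : Prop :=
  MemL2loc f ∧ ∀ i : Fin 2, ∃ g : Plane → F, IsWeakPartial i f g ∧ MemL2loc g

open Classical in
/-- The weak partial derivative of `f` in the `i`-th coordinate. It is determined up to equality
almost everywhere; the value is `0` if `f` has no weak derivative. -/
def weakPartial (i : Fin 2) (f : Plane → F) : Plane → F :=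
  if h : ∃ g : Plane → F, IsWeakPartial i f g then h.choose else 0

end Sobolev

/-- `curl a = ∂a_y/∂x - ∂a_x/∂y`, in the weak sense. -/
def curl (a : Plane → Plane) : Plane → ℝ := fun z =>
  weakPartial 0 (fun w => a w 1) z - weakPartial 1 (fun w => a w 0) z

/-- `div a = ∂a_x/∂x + ∂a_y/∂y`, in the weak sense. -/
def divergence (a : Plane → Plane) : Plane → ℝ := fun z =>
  weakPartial 0 (fun w => a w 0) z + weakPartial 1 (fun w => a w 1) z

/-- The potential `A₀(x, y) = π (-y, x)`. -/
def A0 : Plane → Plane := fun z => !₂[-(Real.pi * z 1), Real.pi * z 0]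

/-- The space `𝒜` of pairs `(u, a)`: `u` is an `H¹_loc` section of the line bundle over `ℝ² / L`
with multipliers `exp (iπ (v_x y - v_y x))` for the two vectors `v` of the basis `b` of the
lattice `L`, and `a` is an `L`-periodic, divergence free `H¹_loc` vector field of mean zero.
Functions are identified when they agree almost everywhere.

The multipliers are prescribed on a basis: for generators `v, w` of a lattice of covolume one,
the factor belonging to `m v + n w` is then `(-1) ^ (m n)` times the same exponential, and no
nonzero function has the exponential itself as multiplier for all lattice vectors at once. -/
structure MemA (L : Submodule ℤ Plane) (b : Module.Basis (Fin 2) ℤ L) (Ω : Set Plane)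
    (u : Plane → ℂ) (a : Plane → Plane) : Prop where
  u_mem : MemH1loc u
  u_section : ∀ j : Fin 2, ∀ᵐ z : Plane,
    u (z + (b j : Plane)) =
      Complex.exp (Complex.I *
        (Real.pi * ((b j : Plane) 0 * z 1 - (b j : Plane) 1 * z 0) : ℝ)) * u z
  a_mem : ∀ j : Fin 2, MemH1loc (fun z => a z j)
  a_div : ∀ᵐ z : Plane, divergence a z = 0
  a_periodic : ∀ v ∈ L, ∀ᵐ z : Plane, a (z + v) = a z
  a_mean : ∀ j : Fin 2, ∫ z in Ω, a z j = 0

/-- `μ = H_int / (2 π k)`. -/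
def mu (k Hint : ℝ) : ℝ := Hint / (2 * Real.pi * k)

/-- The `j`-th component of `i ∇u + C u`. -/
def covGrad (C : Plane → Plane) (u : Plane → ℂ) (j : Fin 2) : Plane → ℂ := fun z =>
  Complex.I * weakPartial j u z + (C z j : ℂ) * u z

/-- `D₊ u = ∂u/∂x + i ∂u/∂y + (C_y - i C_x) u`. -/
def Dplus (C : Plane → Plane) (u : Plane → ℂ) : Plane → ℂ := fun z =>
  weakPartial 0 u z + Complex.I * weakPartial 1 u z +
    ((C z 1 : ℂ) - Complex.I * (C z 0 : ℂ)) * u z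

/-- The density of the functional `E_{k, H_int}`. -/
def energyDensity (k Hint : ℝ) (u : Plane → ℂ) (a : Plane → Plane) : Plane → ℝ := fun z =>
  mu k Hint / 2 * (∑ j : Fin 2, ‖covGrad (A0 + a) u j z‖ ^ 2) +
    1 / 4 * (1 - ‖u z‖ ^ 2) ^ 2 + mu k Hint ^ 2 * k ^ 2 / 2 * |curl a z| ^ 2

/-- The functional `E_{k, H_int}`. -/
def energy (Ω : Set Plane) (k Hint : ℝ) (u : Plane → ℂ) (a : Plane → Plane) : ℝ :=
  ∫ z in Ω, energyDensity k Hint u a z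

/-- The density of the functional `A_{+, H_int}`, where `μ = H_int / (2 π k)`. -/
def AplusDensity (k Hint : ℝ) (u : Plane → ℂ) (a : Plane → Plane) : Plane → ℝ := fun z =>
  mu k Hint / 2 * ‖Dplus (A0 + a) u z‖ ^ 2 +
    1 / 4 * |mu k Hint * curl (A0 + a) z - (1 - ‖u z‖ ^ 2)| ^ 2

/-- The functional `A_{+, H_int}`, where `μ = H_int / (2 π k)`. -/
def Aplus (Ω : Set Plane) (k Hint : ℝ) (u : Plane → ℂ) (a : Plane → Plane) : ℝ :=
  ∫ z in Ω, AplusDensity k Hint u a z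

end GinzburgLandau

end

/-!
The identity is the completion of squares of Bogomolny, carried out for weak derivatives.

Put `Dⱼ = ∂ⱼ - i Cⱼ`, so that `D₊ = D₀ + i D₁` and `|i ∇u + C u|² = |D₀u|² + |D₁u|²`. Pointwise,
`|D₊u|² = |D₀u|² + |D₁u|² - Im G - (curl C) |u|²`, where
`G = conj (D₀u) D₁u - conj (D₁u) D₀u - i (curl C) |u|²` (`currentCurl`). Since
`curl C = 2π + curl a`, expanding the squares at `k² = 1/2` gives, almost everywhere,
`E = A₊ + μπ - (μπ)² + (μ/2) Im G + (μ/2 - μ²π) curl a` for the densities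
(`MemA.ae_energyDensity_eq`). As `Ω` has area one, it remains to see that `G` and `curl a` have
mean zero.

Both are weak divergences of periodic, locally integrable fields. For `curl a` this is the
definition. `G` is the weak curl of `ū Du` (`integral_smul_currentCurl`): it is the sum of the
Jacobian of `(ū, u)`, which is the weak curl of `ū ∇u` (`IsWeakGrad.integral_jacobian`), and of
`-i curl (|u|² C)`, for which the Leibniz rule is needed (`IsWeakGrad.isWeakPartial_mul`). Both
formulas hold when one factor is smooth and pass to the limit by Hölder's inequality: in the plane
`H¹_loc ⊆ L⁴_loc`, and mollification converges in `L⁴_loc` with gradients converging in `L²_loc`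
(`exists_smooth_approx`). The same embedding makes the densities locally integrable.

The gauge covariance of `u`, the periodicity of `a`, and the uniqueness of weak derivatives show that
the `Dⱼu` transform with the multipliers of `u`, so that `G`, `ū Du` and the densities are periodic
(`MemA.ae_translate`). A periodic weak divergence `f = div g` has mean zero
(`setIntegral_eq_zero_of_weak_divergence`): for a test function `ρ` of integral one, the average of
`ρ ⋆ f = ∑ ∂ᵢρ ⋆ gᵢ` over a bounded fundamental domain is the mean of `f`, and it is also
`∑ (∫ ∂ᵢρ) (∫ gᵢ) = 0`. Means and integrability over the possibly unbounded `Ω` are compared with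
those over the bounded domain through exactly periodic representatives.
-/


open scoped ContDiff

namespace GinzburgLandau

open Filter Topology Metric Convolution ContinuousLinearMap Pointwise ComplexConjugate

/-! ### Weak partial derivatives -/

theorem _root_.MeasureTheory.LocallyIntegrable.congr_ae {F : Type*}
    [NormedAddCommGroup F] {f f' : Plane → F} (h : LocallyIntegrable f volume)
    (hf : f =ᵐ[volume] f') : LocallyIntegrable f' volume := fun x => by
  obtain ⟨s, hs, hi⟩ := h x
  exact ⟨s, hs, hi.congr (ae_restrict_of_ae hf)⟩

section WeakPartial

variable {F G : Type*} [NormedAddCommGroup F] [NormedSpace ℝ F] [NormedAddCommGroup G]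
  [NormedSpace ℝ G] {i : Fin 2} {f f' g g' : Plane → F}

/-- The classical partial derivative in the `i`-th coordinate. -/
noncomputable abbrev pderiv (i : Fin 2) (f : Plane → F) : Plane → F :=
  fun z => fderiv ℝ f z (EuclideanSpace.single i 1)

theorem continuous_pderiv (hf : ContDiff ℝ 1 f) : Continuous (pderiv i f) :=
  (hf.continuous_fderiv one_ne_zero).clm_apply continuous_const

theorem contDiff_pderiv (hf : ContDiff ℝ ∞ f) : ContDiff ℝ ∞ (pderiv i f) :=
  (hf.fderiv_right (m := ∞) (by simp)).clm_apply contDiff_const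

theorem hasCompactSupport_pderiv (hf : HasCompactSupport f) : HasCompactSupport (pderiv i f) :=
  hf.fderiv_apply (𝕜 := ℝ) _

theorem pderiv_comp_sub_left {r : Plane → ℝ} (hr : Differentiable ℝ r) (i : Fin 2) (x t : Plane) :
    pderiv i (fun t => r (x - t)) t = - pderiv i r (x - t) := by
  have := (hr (x - t)).hasFDerivAt.comp t ((hasFDerivAt_id t).const_sub x)
  simp only [Function.comp_def] at this
  simp [pderiv, this.fderiv]

theorem IsWeakPartial.ae_eq [CompleteSpace F] (h : IsWeakPartial i f g) (h' : IsWeakPartial i f g') :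
    g =ᵐ[volume] g' := by
  refine ae_eq_of_integral_contDiff_smul_eq h.2.1 h'.2.1 fun φ hφ hc => ?_
  have := (h.2.2 φ hφ hc).symm.trans (h'.2.2 φ hφ hc)
  exact neg_injective this

theorem IsWeakPartial.weakPartial_ae_eq [CompleteSpace F] (h : IsWeakPartial i f g) :
    weakPartial i f =ᵐ[volume] g := by
  have hex : ∃ g : Plane → F, IsWeakPartial i f g := ⟨g, h⟩
  rw [weakPartial, dif_pos hex]
  exact hex.choose_spec.ae_eq h

theorem IsWeakPartial.congr (h : IsWeakPartial i f g) (hf : f =ᵐ[volume] f')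
    (hg : g =ᵐ[volume] g') : IsWeakPartial i f' g' := by
  refine ⟨h.1.congr_ae hf, h.2.1.congr_ae hg, fun φ hφ hc => ?_⟩
  rw [← integral_congr_ae (hf.mono fun z hz => congrArg (pderiv i φ z • ·) hz),
    ← integral_congr_ae (hg.mono fun z hz => congrArg (φ z • ·) hz)]
  exact h.2.2 φ hφ hc

theorem IsWeakPartial.add (h : IsWeakPartial i f g) (h' : IsWeakPartial i f' g') :
    IsWeakPartial i (f + f') (g + g') := by
  refine ⟨h.1.add h'.1, h.2.1.add h'.2.1, fun φ hφ hc => ?_⟩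
  have hd := continuous_pderiv (i := i) (hφ.of_le (by simp))
  have hdc := hasCompactSupport_pderiv (i := i) hc
  simp only [Pi.add_apply, smul_add]
  rw [integral_add (h.1.integrable_smul_left_of_hasCompactSupport hd hdc)
      (h'.1.integrable_smul_left_of_hasCompactSupport hd hdc),
    integral_add (h.2.1.integrable_smul_left_of_hasCompactSupport hφ.continuous hc)
      (h'.2.1.integrable_smul_left_of_hasCompactSupport hφ.continuous hc),
    h.2.2 φ hφ hc, h'.2.2 φ hφ hc, neg_add]

theorem _root_.MeasureTheory.LocallyIntegrable.clm_comp (h : LocallyIntegrable f volume)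
    (T : F →L[ℝ] G) : LocallyIntegrable (fun z => T (f z)) volume := fun x => by
  obtain ⟨s, hs, hi⟩ := h x
  exact ⟨s, hs, T.integrable_comp hi⟩

theorem IsWeakPartial.clm_comp [CompleteSpace F] [CompleteSpace G] (h : IsWeakPartial i f g)
    (T : F →L[ℝ] G) : IsWeakPartial i (fun z => T (f z)) (fun z => T (g z)) := by
  refine ⟨h.1.clm_comp T, h.2.1.clm_comp T, fun φ hφ hc => ?_⟩
  have hd := continuous_pderiv (i := i) (hφ.of_le (by simp))
  have hdc := hasCompactSupport_pderiv (i := i) hc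
  simp only [← T.map_smul]
  rw [T.integral_comp_comm (h.1.integrable_smul_left_of_hasCompactSupport hd hdc),
    T.integral_comp_comm (h.2.1.integrable_smul_left_of_hasCompactSupport hφ.continuous hc),
    h.2.2 φ hφ hc, map_neg]

theorem IsWeakPartial.of_contDiff (hf : ContDiff ℝ 1 f) : IsWeakPartial i f (pderiv i f) := by
  have hd := continuous_pderiv (i := i) hf
  refine ⟨hf.continuous.locallyIntegrable, hd.locallyIntegrable, fun φ hφ hc => ?_⟩
  have hdφ := continuous_pderiv (i := i) (hφ.of_le (by simp : (1 : ℕ∞ω) ≤ ∞))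
  have hdc := hasCompactSupport_pderiv (i := i) hc
  rw [integral_smul_fderiv_eq_neg_fderiv_smul_of_integrable, neg_neg]
  · exact hf.continuous.locallyIntegrable.integrable_smul_left_of_hasCompactSupport hdφ hdc
  · exact hd.locallyIntegrable.integrable_smul_left_of_hasCompactSupport hφ.continuous hc
  · exact hf.continuous.locallyIntegrable.integrable_smul_left_of_hasCompactSupport hφ.continuous hc
  · exact fun z _ => hφ.differentiable (by simp) z
  · exact fun z _ => hf.differentiable one_ne_zero z

theorem IsWeakPartial.comp_add_right (h : IsWeakPartial i f g) (v : Plane) :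
    IsWeakPartial i (fun z => f (z + v)) (fun z => g (z + v)) := by
  have key : ∀ {k : Plane → F}, LocallyIntegrable k volume →
      LocallyIntegrable (fun z => k (z + v)) volume := fun {k} hk x => by
    obtain ⟨s, hs, hi⟩ := hk (x + v)
    refine ⟨(· + v) ⁻¹' s, (continuous_add_const v).continuousAt.preimage_mem_nhds hs, ?_⟩
    exact ((measurePreserving_add_right volume v).integrableOn_comp_preimage
      (measurableEmbedding_addRight v)).2 hi
  refine ⟨key h.1, key h.2.1, fun φ hφ hc => ?_⟩
  have hT : ContDiff ℝ ∞ (fun z : Plane => φ (z - v)) := hφ.comp (contDiff_id.sub contDiff_const)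
  have hTc : HasCompactSupport (fun z : Plane => φ (z - v)) :=
    hc.comp_homeomorph (Homeomorph.subRight v)
  have := h.2.2 _ hT hTc
  rw [← integral_add_right_eq_self _ v, ← integral_add_right_eq_self (fun z => φ (z - v) • g z) v]
    at this
  simpa [fderiv_comp_sub] using this

end WeakPartial

section Complex

variable {i : Fin 2} {f g : Plane → ℂ}

/-- A weak partial derivative of a complex function may be tested against complex functions. -/
theorem IsWeakPartial.integral_pderiv_mul (h : IsWeakPartial i f g) {φ : Plane → ℂ}
    (hφ : ContDiff ℝ ∞ φ) (hc : HasCompactSupport φ) :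
    ∫ z, pderiv i φ z * f z = - ∫ z, φ z * g z := by
  have part : ∀ T : ℂ →L[ℝ] ℝ, ∫ z, ((T (pderiv i φ z) : ℝ) : ℂ) * f z =
      - ∫ z, ((T (φ z) : ℝ) : ℂ) * g z := fun T => by
    have h1 : ContDiff ℝ ∞ (fun z => T (φ z)) := T.contDiff.comp hφ
    have h2 : HasCompactSupport (fun z => T (φ z)) := hc.comp_left (g := T) (map_zero T)
    have h3 := h.2.2 _ h1 h2
    have h4 : ∀ z, fderiv ℝ (fun z => T (φ z)) z (EuclideanSpace.single i 1) =
        T (pderiv i φ z) := fun z => by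
      have := (T.hasFDerivAt (x := φ z)).comp z
        ((hφ.differentiable (by simp)) z).hasFDerivAt
      have h5 := this.fderiv
      simp only [Function.comp_def] at h5
      rw [h5]; rfl
    simp only [h4, Complex.real_smul] at h3
    exact h3
  have int : ∀ {k : Plane → ℂ} {ψ : Plane → ℂ}, LocallyIntegrable k volume → Continuous ψ →
      HasCompactSupport ψ → ∀ T : ℂ →L[ℝ] ℝ,
      Integrable (fun z => ((T (ψ z) : ℝ) : ℂ) * k z) := fun {k ψ} hk hψ hψc T => by
    have := hk.integrable_smul_left_of_hasCompactSupport (T.continuous.comp hψ)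
      (hψc.comp_left (g := T) (map_zero T))
    simpa [Complex.real_smul] using this
  have hd := continuous_pderiv (i := i) (hφ.of_le (by simp))
  have hdc := hasCompactSupport_pderiv (i := i) hc
  have split : ∀ {k : Plane → ℂ} {ψ : Plane → ℂ}, LocallyIntegrable k volume → Continuous ψ →
      HasCompactSupport ψ → ∫ z, ψ z * k z = (∫ z, ((Complex.reCLM (ψ z) : ℝ) : ℂ) * k z) +
        Complex.I * ∫ z, ((Complex.imCLM (ψ z) : ℝ) : ℂ) * k z := fun {k ψ} hk hψ hψc => by
    rw [← integral_const_mul, ← integral_add (int hk hψ hψc _) ((int hk hψ hψc _).const_mul _)]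
    refine integral_congr_ae (.of_forall fun z => ?_)
    simp only [Complex.reCLM_apply, Complex.imCLM_apply]
    conv_lhs => rw [← Complex.re_add_im (ψ z)]
    ring
  rw [split h.1 hd hdc, split h.2.1 hφ.continuous hc, part, part]
  ring

theorem pderiv_mul {f g : Plane → ℂ} {z : Plane} (hf : DifferentiableAt ℝ f z)
    (hg : DifferentiableAt ℝ g z) : pderiv i (fun z => f z * g z) z =
      f z * pderiv i g z + g z * pderiv i f z := by
  simp [pderiv, fderiv_fun_mul hf hg]

theorem pderiv_ofReal {i : Fin 2} {φ : Plane → ℝ} (hφ : ContDiff ℝ ∞ φ) (z : Plane) :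
    pderiv i (fun z => (φ z : ℂ)) z = ((pderiv i φ z : ℝ) : ℂ) := by
  have := (Complex.ofRealCLM.hasFDerivAt (x := φ z)).comp z
    ((hφ.differentiable (by simp)) z).hasFDerivAt
  have h5 := this.fderiv
  simp only [Function.comp_def, Complex.ofRealCLM_apply] at h5
  simp only [pderiv]
  rw [h5]; rfl

/-- Leibniz rule for a weak partial derivative and a smooth factor. -/
theorem IsWeakPartial.contDiff_mul (h : IsWeakPartial i f g) {χ : Plane → ℂ}
    (hχ : ContDiff ℝ ∞ χ) :
    IsWeakPartial i (fun z => χ z * f z) (fun z => χ z * g z + pderiv i χ z * f z) := by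
  have hdχ := contDiff_pderiv (i := i) hχ
  refine ⟨h.1.continuous_mul hχ.continuous, (h.2.1.continuous_mul hχ.continuous).add
    (h.1.continuous_mul hdχ.continuous), fun φ hφ hc => ?_⟩
  have hφ' : ContDiff ℝ ∞ (fun z => (φ z : ℂ)) := Complex.ofRealCLM.contDiff.comp hφ
  have hc' : HasCompactSupport (fun z => (φ z : ℂ)) := hc.comp_left Complex.ofReal_zero
  have hd := pderiv_ofReal (i := i) hφ
  have h1 := h.integral_pderiv_mul (hφ'.mul hχ) (hc'.mul_right (f' := χ))
  have h2 : ∀ z, pderiv i (fun z => (φ z : ℂ) * χ z) z =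
      φ z * pderiv i χ z + χ z * ((pderiv i φ z : ℝ) : ℂ) := fun z => by
    rw [pderiv_mul (hφ'.differentiable (by simp) z) (hχ.differentiable (by simp) z), hd]
  have i1 : Integrable (fun z => (φ z : ℂ) * pderiv i χ z * f z) := by
    have := h.1.integrable_smul_left_of_hasCompactSupport
      (hφ'.continuous.mul hdχ.continuous) (hc'.mul_right (f' := pderiv i χ))
    simpa using this
  have i2 : Integrable (fun z => χ z * ((pderiv i φ z : ℝ) : ℂ) * f z) := by
    have hc1 : HasCompactSupport (fun z => ((pderiv i φ z : ℝ) : ℂ)) :=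
      (hasCompactSupport_pderiv (i := i) hc).comp_left Complex.ofReal_zero
    have := h.1.integrable_smul_left_of_hasCompactSupport
      (hχ.continuous.mul (Complex.continuous_ofReal.comp
        (continuous_pderiv (i := i) (hφ.of_le (by simp))))) (hc1.mul_left (f := χ))
    simpa using this
  have i3 : Integrable (fun z => (φ z : ℂ) * χ z * g z) := by
    have := h.2.1.integrable_smul_left_of_hasCompactSupport
      (hφ'.continuous.mul hχ.continuous) (hc'.mul_right (f' := χ))
    simpa using this
  simp only [h2, add_mul] at h1
  rw [integral_add i1 i2] at h1
  have h3 : ∫ z, φ z • (χ z * g z + pderiv i χ z * f z) =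
      (∫ z, (φ z : ℂ) * χ z * g z) + ∫ z, (φ z : ℂ) * pderiv i χ z * f z := by
    rw [← integral_add i3 i1]
    exact integral_congr_ae (.of_forall fun z => by simp only [Complex.real_smul]; ring)
  have h4 : ∫ z, pderiv i φ z • (χ z * f z) = ∫ z, χ z * ((pderiv i φ z : ℝ) : ℂ) * f z :=
    integral_congr_ae (.of_forall fun z => by simp only [Complex.real_smul]; ring)
  rw [h3]
  refine h4.trans ?_
  linear_combination h1

end Complex

/-! ### Mollification and the Sobolev inequality -/

section Mollification

/-- Translations act continuously on `L²`. -/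
theorem tendsto_eLpNorm_translate_sub {f : Plane → ℂ} (hf : MemLp f 2 volume) :
    Tendsto (fun v : Plane => eLpNorm (fun z => f (z - v) - f z) 2 volume) (𝓝 0) (𝓝 0) := by
  have hmp : ∀ v : Plane, MeasurePreserving (fun z : Plane => z - v) volume volume :=
    fun v => measurePreserving_sub_right volume v
  let T : Plane → C(Plane, Plane) :=
    (ContinuousMap.curry ⟨fun p : Plane × Plane => p.2 - p.1, by fun_prop⟩ :
      C(Plane, C(Plane, Plane)))
  have hT : Continuous T := (ContinuousMap.curry _).continuous
  have hmT : ∀ v, MeasurePreserving (T v) volume volume := hmp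
  have hc := (continuous_const (y := hf.toLp f)).compMeasurePreservingLp hT hmT (by simp)
  have h0 := (hc.tendsto 0)
  rw [Lp.tendsto_Lp_iff_tendsto_eLpNorm'] at h0
  refine h0.congr fun v => eLpNorm_congr_ae ?_
  have e : ∀ v, (Lp.compMeasurePreserving (T v) (hmT v) (hf.toLp f) : Plane → ℂ) =ᵐ[volume]
      fun z => f (z - v) := fun v =>
    (Lp.coeFn_compMeasurePreserving _ (hmT v)).trans
      ((hmT v).quasiMeasurePreserving.ae_eq_comp hf.coeFn_toLp)
  filter_upwards [e v, e 0] with z h1 h2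
  simp only [Pi.sub_apply, h1, h2, sub_zero]

/-- By Jensen's inequality, a mollified function is at least as close to `f` in `L²` as the
translates of `f` over the support of the mollifier. -/
theorem eLpNorm_convolution_sub_le {f : Plane → ℂ} (hf : MemLp f 2 volume)
    (ρ : ContDiffBump (0 : Plane)) {C : ENNReal}
    (hC : ∀ v ∈ ball (0 : Plane) ρ.rOut, eLpNorm (fun z => f (z - v) - f z) 2 volume ≤ C) :
    eLpNorm (fun z => (ρ.normed volume ⋆[lsmul ℝ ℝ, volume] f) z - f z) 2 volume ≤ C := by
  set r : Plane → ℝ := ρ.normed volume with hr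
  have hr0 : ∀ v, 0 ≤ r v := ρ.nonneg_normed
  have hrc : Continuous r := ρ.continuous_normed
  have hri : ∫ v, r v = 1 := ρ.integral_normed
  have hrint : Integrable r := ρ.integrable_normed
  let ν : Measure Plane := volume.withDensity fun v => ENNReal.ofReal (r v)
  have hrm : Measurable fun v => ENNReal.ofReal (r v) := hrc.measurable.ennreal_ofReal
  have hν : IsProbabilityMeasure ν := ⟨by
    rw [withDensity_apply _ MeasurableSet.univ, Measure.restrict_univ,
      ← ofReal_integral_eq_lintegral_ofReal hrint (.of_forall hr0), hri, ENNReal.ofReal_one]⟩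
  have hνac : ν ≪ volume := withDensity_absolutelyContinuous _ _
  have hfm := hf.1
  have hdm : AEStronglyMeasurable (fun p : Plane × Plane => f (p.1 - p.2) - f p.1)
      ((volume : Measure Plane).prod volume) :=
    (hfm.comp_quasiMeasurePreserving
      (quasiMeasurePreserving_sub_of_right_invariant volume volume)).sub hfm.comp_fst
  have hdm' : AEStronglyMeasurable (fun p : Plane × Plane => f (p.1 - p.2) - f p.1)
      ((volume : Measure Plane).prod ν) :=
    hdm.mono_ac (Measure.AbsolutelyContinuous.rfl.prod hνac)
  have hsq : ∀ {α : Type} [MeasurableSpace α] (m : Measure α) (k : α → ℂ),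
      eLpNorm k 2 m ^ 2 = ∫⁻ x, ‖k x‖ₑ ^ 2 ∂m := fun m k => by
    have := eLpNorm_nnreal_pow_eq_lintegral (f := k) (μ := m) (p := 2) (by norm_num)
    rw [← ENNReal.rpow_natCast]
    simpa only [NNReal.coe_ofNat, ENNReal.coe_ofNat, Nat.cast_ofNat, ENNReal.rpow_ofNat] using this
  -- Jensen's inequality for the probability measure `ν`, in the form `L²(ν) ⊆ L¹(ν)`.
  have hpt : ∀ᵐ x : Plane, ‖(r ⋆[lsmul ℝ ℝ, volume] f) x - f x‖ₑ ^ 2 ≤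
      ∫⁻ v, ‖f (x - v) - f x‖ₑ ^ 2 ∂ν := by
    filter_upwards [hdm'.prodMk_left] with x hx
    have hex : Integrable (fun v => r v • f (x - v)) :=
      ρ.hasCompactSupport_normed.convolutionExists_left (lsmul ℝ ℝ) hrc
        (hf.locallyIntegrable one_le_two) x
    have h1 : (r ⋆[lsmul ℝ ℝ, volume] f) x - f x = ∫ v, r v • (f (x - v) - f x) := by
      simp only [smul_sub]
      rw [integral_sub hex (hrint.smul_const _), integral_smul_const, hri, one_smul]
      rfl
    have h2 : ‖(r ⋆[lsmul ℝ ℝ, volume] f) x - f x‖ₑ ≤ ∫⁻ v, ‖f (x - v) - f x‖ₑ ∂ν := by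
      rw [h1, lintegral_withDensity_eq_lintegral_mul₀' hrm.aemeasurable hx.enorm]
      refine (enorm_integral_le_lintegral_enorm _).trans_eq (lintegral_congr fun v => ?_)
      rw [enorm_smul, Real.enorm_of_nonneg (hr0 v)]; rfl
    have h3 : ∫⁻ v, ‖f (x - v) - f x‖ₑ ∂ν ≤ eLpNorm (fun v => f (x - v) - f x) 2 ν := by
      rw [← eLpNorm_one_eq_lintegral_enorm]
      exact eLpNorm_le_eLpNorm_of_exponent_le one_le_two hx
    rw [← hsq]
    exact pow_le_pow_left' (h2.trans h3) 2
  have hle : eLpNorm (fun z => (r ⋆[lsmul ℝ ℝ, volume] f) z - f z) 2 volume ^ 2 ≤ C ^ 2 := by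
    rw [hsq]
    calc _ ≤ ∫⁻ x, ∫⁻ v, ‖f (x - v) - f x‖ₑ ^ 2 ∂ν := lintegral_mono_ae hpt
      _ = ∫⁻ v, ∫⁻ x, ‖f (x - v) - f x‖ₑ ^ 2 ∂volume ∂ν :=
          lintegral_lintegral_swap (hdm'.enorm.pow_const 2)
      _ ≤ ∫⁻ v, C ^ 2 ∂ν := by
          rw [lintegral_withDensity_eq_lintegral_mul_non_measurable₀ _ hrm.aemeasurable (by simp),
            lintegral_withDensity_eq_lintegral_mul_non_measurable₀ _ hrm.aemeasurable (by simp)]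
          refine lintegral_mono fun v => ?_
          by_cases hv : v ∈ ball (0 : Plane) ρ.rOut
          · simp only [Pi.mul_apply]
            gcongr
            rw [← hsq]
            exact pow_le_pow_left' (hC v hv) 2
          · have : r v = 0 := by
              rw [← Function.notMem_support, hr, ρ.support_normed_eq]; exact hv
            simp [this]
      _ = C ^ 2 := by simp
  exact (ENNReal.pow_le_pow_left_iff two_ne_zero).1 hle

theorem tendsto_eLpNorm_convolution_sub {f : Plane → ℂ} (hf : MemLp f 2 volume)
    {ρ : ℕ → ContDiffBump (0 : Plane)} (hρ : Tendsto (fun n => (ρ n).rOut) atTop (𝓝 0)) :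
    Tendsto (fun n => eLpNorm (fun z =>
      ((ρ n).normed volume ⋆[lsmul ℝ ℝ, volume] f) z - f z) 2 volume) atTop (𝓝 0) := by
  rw [ENNReal.tendsto_nhds_zero]
  intro ε hε
  have h1 := ENNReal.tendsto_nhds_zero.1 (tendsto_eLpNorm_translate_sub hf) ε hε
  obtain ⟨δ, hδ, hball⟩ := Metric.eventually_nhds_iff_ball.1 h1
  filter_upwards [hρ.eventually (gt_mem_nhds hδ)] with n hn
  exact eLpNorm_convolution_sub_le hf (ρ n) fun v hv => hball v (ball_subset_ball hn.le hv)

/-- Mollification turns a weak partial derivative into a classical one. -/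
theorem pderiv_convolution {i : Fin 2} {f g : Plane → ℂ} (h : IsWeakPartial i f g)
    (ρ : ContDiffBump (0 : Plane)) :
    pderiv i (ρ.normed volume ⋆[lsmul ℝ ℝ, volume] f) =
      (ρ.normed volume ⋆[lsmul ℝ ℝ, volume] g) := by
  funext x
  set r : Plane → ℝ := ρ.normed volume with hr
  have hrs : ContDiff ℝ ∞ r := ρ.contDiff_normed
  have hrc : HasCompactSupport r := ρ.hasCompactSupport_normed
  have hD := hrc.hasFDerivAt_convolution_left (lsmul ℝ ℝ) (μ := volume)
    (hrs.of_le (by simp : (1 : ℕ∞ω) ≤ ∞)) h.1 x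
  have hφ : ContDiff ℝ ∞ (fun t => r (x - t)) := hrs.comp (contDiff_const.sub contDiff_id)
  have hφc : HasCompactSupport (fun t => r (x - t)) :=
    hrc.comp_homeomorph (Homeomorph.subLeft x)
  have hdφ := pderiv_comp_sub_left (hrs.differentiable (by simp)) i x
  have key := h.2.2 _ hφ hφc
  rw [convolution_eq_swap]
  simp only [lsmul_apply]
  rw [← neg_eq_iff_eq_neg.2 key]
  simp only [pderiv]
  have hi : ConvolutionExistsAt (fderiv ℝ r) f x ((lsmul ℝ ℝ).precompL Plane) volume :=
    (hrc.fderiv ℝ).convolutionExists_left _ (hrs.continuous_fderiv (by simp)) h.1 x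
  rw [hD.fderiv, convolution_eq_swap, ContinuousLinearMap.integral_apply hi.integrable_swap,
    ← integral_neg]
  refine integral_congr_ae (.of_forall fun t => ?_)
  have := hdφ t
  simp only [pderiv] at this
  simp [this, precompL_apply]

end Mollification

section Sobolev

theorem norm_clm_le_sum (T : Plane →L[ℝ] ℂ) :
    ‖T‖ ≤ ‖T (EuclideanSpace.single 0 1)‖ + ‖T (EuclideanSpace.single 1 1)‖ := by
  refine T.opNorm_le_bound (by positivity) fun v => ?_
  have hv : v = v 0 • EuclideanSpace.single 0 (1 : ℝ) + v 1 • EuclideanSpace.single 1 (1 : ℝ) := by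
    ext j; fin_cases j <;> simp
  have h0 : ‖v 0‖ ≤ ‖v‖ := PiLp.norm_apply_le v 0
  have h1 : ‖v 1‖ ≤ ‖v‖ := PiLp.norm_apply_le v 1
  calc ‖T v‖ = ‖v 0 • T (EuclideanSpace.single 0 1) + v 1 • T (EuclideanSpace.single 1 1)‖ := by
        conv_lhs => rw [hv]
        simp
    _ ≤ ‖v 0‖ * ‖T (EuclideanSpace.single 0 1)‖ + ‖v 1‖ * ‖T (EuclideanSpace.single 1 1)‖ := by
        refine (norm_add_le _ _).trans ?_
        rw [norm_smul, norm_smul]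
    _ ≤ _ := by
        rw [add_mul, mul_comm _ ‖v‖, mul_comm _ ‖v‖]
        gcongr

/-- The two-dimensional Sobolev inequality `‖w‖₄ ≤ C ‖∇w‖₂` for functions supported in a ball. -/
theorem exists_eLpNorm_four_le (R : ℝ) : ∃ C : ENNReal, C ≠ ⊤ ∧ ∀ w : Plane → ℂ, ContDiff ℝ 1 w →
    tsupport w ⊆ closedBall 0 R →
    eLpNorm w 4 volume ≤ C * (eLpNorm (pderiv 0 w) 2 volume + eLpNorm (pderiv 1 w) 2 volume) := by
  obtain ⟨B, hB⟩ : ∃ B, B = closedBall (0 : Plane) R := ⟨_, rfl⟩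
  rw [← hB]
  -- Any exponent in `[4/3, 2)` on the right hand side would do in place of `3/2`.
  obtain ⟨K, hK⟩ : ∃ K : NNReal, ∀ w : Plane → ℂ, ContDiff ℝ 1 w → tsupport w ⊆ B →
      eLpNorm w 4 volume ≤ K * eLpNorm (fderiv ℝ w) ((3 / 2 : NNReal) : ENNReal) volume :=
    ⟨_, fun w hw hs => eLpNorm_le_eLpNorm_fderiv_of_le (volume : Measure Plane) hw
      ((subset_tsupport w).trans hs) (p := 3 / 2) (q := 4)
      (by rw [← NNReal.coe_le_coe]; norm_num)
      (by rw [← NNReal.coe_lt_coe]; norm_num)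
      (by norm_num) (hB ▸ isBounded_closedBall)⟩
  obtain ⟨m, hm, hH⟩ : ∃ m : ENNReal, m ≠ ⊤ ∧ ∀ g : Plane → ℝ,
      AEStronglyMeasurable g (volume.restrict B) →
      eLpNorm g ((3 / 2 : NNReal) : ENNReal) (volume.restrict B) ≤
        eLpNorm g 2 (volume.restrict B) * m := by
    refine ⟨_, ?_, fun g hg => eLpNorm_le_eLpNorm_mul_rpow_measure_univ ?_ hg⟩
    · refine ENNReal.rpow_ne_top_of_nonneg ?_ ?_
      · norm_num
      · rw [Measure.restrict_apply_univ]
        exact hB ▸ measure_closedBall_lt_top.ne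
    · rw [← ENNReal.coe_ofNat, ENNReal.coe_le_coe, ← NNReal.coe_le_coe]
      norm_num
  refine ⟨K * m, ENNReal.mul_ne_top ENNReal.coe_ne_top hm, fun w hw hs => ?_⟩
  have hfs : Function.support (fun z => ‖fderiv ℝ w z‖) ⊆ B := fun z hz =>
    hs (support_fderiv_subset ℝ (norm_ne_zero_iff.1 hz))
  have hr : ∀ p : ENNReal, eLpNorm (fderiv ℝ w) p volume =
      eLpNorm (fun z => ‖fderiv ℝ w z‖) p (volume.restrict B) := fun p => by
    rw [eLpNorm_restrict_eq_of_support_subset hfs, eLpNorm_norm]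
  have hcd := hw.continuous_fderiv one_ne_zero
  have h2 : eLpNorm (fderiv ℝ w) ((3 / 2 : NNReal) : ENNReal) volume ≤
      eLpNorm (fderiv ℝ w) 2 volume * m := by
    rw [hr, hr 2]
    exact hH _ hcd.norm.aestronglyMeasurable
  have h3 : eLpNorm (fderiv ℝ w) 2 volume ≤
      eLpNorm (pderiv 0 w) 2 volume + eLpNorm (pderiv 1 w) 2 volume := by
    calc eLpNorm (fderiv ℝ w) 2 volume
        ≤ eLpNorm (fun z => ‖pderiv 0 w z‖ + ‖pderiv 1 w z‖) 2 volume :=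
          eLpNorm_mono_real fun z => norm_clm_le_sum _
      _ ≤ eLpNorm (fun z => ‖pderiv 0 w z‖) 2 volume +
          eLpNorm (fun z => ‖pderiv 1 w z‖) 2 volume :=
          eLpNorm_add_le (continuous_pderiv hw).norm.aestronglyMeasurable
            (continuous_pderiv hw).norm.aestronglyMeasurable one_le_two
      _ = _ := by rw [eLpNorm_norm, eLpNorm_norm]
  refine (hK w hw hs).trans ?_
  rw [mul_assoc, mul_comm m]
  gcongr
  exact h2.trans (by gcongr)

end Sobolev

/-! ### Smooth approximation in `H¹_loc` and limits of integrals -/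

section Approximation

/-- A compactly supported `H¹` function lies in `L⁴`, and smooth functions converge to it in `L⁴`
with gradients converging in `L²`. -/
theorem exists_smooth_approx {f : Plane → ℂ} {f' : Fin 2 → Plane → ℂ} (hf : MemLp f 2 volume)
    (hc : HasCompactSupport f) (hw : ∀ i, IsWeakPartial i f (f' i))
    (hf' : ∀ i, MemLp (f' i) 2 volume) :
    MemLp f 4 volume ∧ ∃ h : ℕ → Plane → ℂ, (∀ n, ContDiff ℝ ∞ (h n)) ∧
      Tendsto (fun n => eLpNorm (h n - f) 4 volume) atTop (𝓝 0) ∧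
      ∀ i, Tendsto (fun n => eLpNorm (pderiv i (h n) - f' i) 2 volume) atTop (𝓝 0) := by
  obtain ⟨R, hR⟩ := hc.isCompact.isBounded.subset_closedBall (0 : Plane)
  let ρ : ℕ → ContDiffBump (0 : Plane) := fun n =>
    ⟨1 / ((n : ℝ) + 1) / 2, 1 / ((n : ℝ) + 1), half_pos Nat.one_div_pos_of_nat,
      half_lt_self Nat.one_div_pos_of_nat⟩
  have hρ : Tendsto (fun n => (ρ n).rOut) atTop (𝓝 0) := tendsto_one_div_add_atTop_nhds_zero_nat
  have hρ2 : ∀ᶠ n in atTop, (ρ n).rOut ≤ 2 * (ρ n).rIn :=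
    .of_forall fun n => by simp only [ρ]; linarith
  have hρ1 : ∀ n, (ρ n).rOut ≤ 1 := fun n => by
    simp only [ρ]
    rw [div_le_one (by positivity)]
    linarith [(n.cast_nonneg : (0 : ℝ) ≤ n)]
  let h : ℕ → Plane → ℂ := fun n => (ρ n).normed volume ⋆[lsmul ℝ ℝ, volume] f
  have hloc : LocallyIntegrable f volume := hf.locallyIntegrable one_le_two
  have hsm : ∀ n, ContDiff ℝ ∞ (h n) := fun n =>
    (ρ n).hasCompactSupport_normed.contDiff_convolution_left (n := ⊤) _ (ρ n).contDiff_normed hloc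
  have hsm1 : ∀ n, ContDiff ℝ 1 (h n) := fun n => (hsm n).of_le (by simp)
  have hcs : ∀ n, HasCompactSupport (h n) := fun n =>
    (ρ n).hasCompactSupport_normed.convolution _ hc
  have hsupp : ∀ n, Function.support (h n) ⊆ closedBall 0 (R + 1) := fun n => by
    refine (support_convolution_subset _).trans ?_
    rintro _ ⟨x, hx, y, hy, rfl⟩
    rw [(ρ n).support_normed_eq, mem_ball_zero_iff] at hx
    have hy' := mem_closedBall_zero_iff.1 (hR (subset_tsupport f hy))
    rw [mem_closedBall_zero_iff]
    linarith [norm_add_le x y, hρ1 n]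
  have hgrad : ∀ i, Tendsto (fun n => eLpNorm (pderiv i (h n) - f' i) 2 volume) atTop (𝓝 0) :=
    fun i => by
      refine (tendsto_eLpNorm_convolution_sub (hf' i) hρ).congr fun n => ?_
      rw [pderiv_convolution (hw i)]
      rfl
  obtain ⟨C, hC, hS⟩ := exists_eLpNorm_four_le (R + 1)
  let ε : Fin 2 → ℕ → ENNReal := fun i n => eLpNorm (pderiv i (h n) - f' i) 2 volume
  have hpm : ∀ i n, AEStronglyMeasurable (pderiv i (h n) - f' i) volume := fun i n =>
    (continuous_pderiv (hsm1 n)).aestronglyMeasurable.sub (hf' i).1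
  have hdiff : ∀ n m, eLpNorm (h n - h m) 4 volume ≤
      C * ((ε 0 n + ε 0 m) + (ε 1 n + ε 1 m)) := fun n m => by
    refine (hS _ ((hsm1 n).sub (hsm1 m)) (closure_minimal ?_ isClosed_closedBall)).trans ?_
    · exact (Function.support_sub _ _).trans (Set.union_subset (hsupp n) (hsupp m))
    · have : ∀ i, eLpNorm (pderiv i (h n - h m)) 2 volume ≤ ε i n + ε i m := fun i => by
        have e : pderiv i (h n - h m) = (pderiv i (h n) - f' i) - (pderiv i (h m) - f' i) := by
          funext z
          simp [pderiv, fderiv_sub ((hsm1 n).differentiable one_ne_zero z)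
            ((hsm1 m).differentiable one_ne_zero z)]
        rw [e]
        exact eLpNorm_sub_le (hpm i n) (hpm i m) one_le_two
      gcongr <;> exact this _
  have hae := ContDiffBump.ae_convolution_tendsto_right_of_locallyIntegrable hρ hρ2 hloc
  have hlim : ∀ n, eLpNorm (h n - f) 4 volume ≤ C * (ε 0 n + ε 1 n) := fun n => by
    -- Fatou's lemma turns the Cauchy property into convergence.
    have h1 := Lp.eLpNorm_lim_le_liminf_eLpNorm (p := 4) (μ := volume)
      (f := fun m => h n - h m) (fun m =>
        ((hsm n).continuous.sub (hsm m).continuous).aestronglyMeasurable) (h n - f)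
      (hae.mono fun z hz => tendsto_const_nhds.sub hz)
    have h2 : Tendsto (fun m => C * ((ε 0 n + ε 0 m) + (ε 1 n + ε 1 m))) atTop
        (𝓝 (C * ((ε 0 n + 0) + (ε 1 n + 0)))) :=
      ENNReal.Tendsto.const_mul ((tendsto_const_nhds.add (hgrad 0)).add
        (tendsto_const_nhds.add (hgrad 1))) (.inr hC)
    calc _ ≤ _ := h1
      _ ≤ liminf (fun m => C * ((ε 0 n + ε 0 m) + (ε 1 n + ε 1 m))) atTop :=
          liminf_le_liminf (.of_forall fun m => hdiff n m)
      _ = _ := by rw [h2.liminf_eq]; simp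
  have htend : Tendsto (fun n => eLpNorm (h n - f) 4 volume) atTop (𝓝 0) := by
    have h2 : Tendsto (fun n => C * (ε 0 n + ε 1 n)) atTop (𝓝 (C * (0 + 0))) :=
      ENNReal.Tendsto.const_mul ((hgrad 0).add (hgrad 1)) (.inr hC)
    rw [add_zero, mul_zero] at h2
    exact tendsto_of_tendsto_of_tendsto_of_le_of_le tendsto_const_nhds h2 (fun _ => zero_le)
      hlim
  refine ⟨?_, h, hsm, htend, hgrad⟩
  obtain ⟨n, hn⟩ := (htend.eventually (gt_mem_nhds ENNReal.zero_lt_top)).exists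
  have h1 : MemLp (h n - f) 4 volume := ⟨(hsm n).continuous.aestronglyMeasurable.sub hf.1, hn⟩
  have h2 : MemLp (h n) 4 volume := (hsm n).continuous.memLp_of_hasCompactSupport (hcs n)
  simpa using h2.sub h1

/-- `f` lies in `H¹_loc` and its weak gradient is `f'`. -/
def IsWeakGrad (f : Plane → ℂ) (f' : Fin 2 → Plane → ℂ) : Prop :=
  MemL2loc f ∧ ∀ i, IsWeakPartial i f (f' i) ∧ MemL2loc (f' i)

/-- `f` is locally in `L⁴`. -/
def MemL4loc (f : Plane → ℂ) : Prop :=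
  ∀ K : Set Plane, IsCompact K → MemLp f 4 (volume.restrict K)

theorem memLp_continuous_mul {p : ENNReal} {μ : Measure Plane} {f χ : Plane → ℂ}
    (hf : MemLp f p μ) (hχ : Continuous χ) (hc : HasCompactSupport χ) :
    MemLp (fun z => χ z * f z) p μ := by
  obtain ⟨C, hC⟩ := hc.exists_bound_of_continuous hχ
  refine hf.of_le_mul (c := C) (hχ.aestronglyMeasurable.mul hf.1) (.of_forall fun z => ?_)
  rw [norm_mul]
  gcongr
  exact hC z

/-- Local version of `exists_smooth_approx`, obtained by multiplying with a cutoff function that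
equals one near `K`. -/
theorem IsWeakGrad.exists_approx {f : Plane → ℂ} {f' : Fin 2 → Plane → ℂ} (hf : IsWeakGrad f f')
    {K : Set Plane} (hK : IsCompact K) :
    MemLp f 4 (volume.restrict K) ∧ ∃ h : ℕ → Plane → ℂ, (∀ n, ContDiff ℝ ∞ (h n)) ∧
      Tendsto (fun n => eLpNorm (h n - f) 4 (volume.restrict K)) atTop (𝓝 0) ∧
      ∀ i, Tendsto (fun n => eLpNorm (pderiv i (h n) - f' i) 2 (volume.restrict K))
        atTop (𝓝 0) := by
  obtain ⟨R, hR0, hR⟩ := hK.isBounded.subset_ball_lt 0 (0 : Plane)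
  let χ : ContDiffBump (0 : Plane) := ⟨R, R + 1, hR0, by linarith⟩
  let η : Plane → ℂ := fun z => (χ z : ℂ)
  have hη : ContDiff ℝ ∞ η := Complex.ofRealCLM.contDiff.comp χ.contDiff
  have hηc : HasCompactSupport η := χ.hasCompactSupport.comp_left Complex.ofReal_zero
  have hη1 : ∀ z ∈ ball (0 : Plane) R, η =ᶠ[𝓝 z] fun _ => 1 := fun z hz => by
    filter_upwards [isOpen_ball.mem_nhds hz] with y hy
    simp [η, χ.one_of_mem_closedBall (ball_subset_closedBall hy)]
  have hη' : ∀ i, ∀ z ∈ ball (0 : Plane) R, pderiv i η z = 0 := fun i z hz => by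
    simp [pderiv, (hη1 z hz).fderiv_eq]
  -- A function in `L²_loc` becomes square integrable when multiplied by a test function.
  have hL2 : ∀ {k ξ : Plane → ℂ}, MemL2loc k → Continuous ξ → HasCompactSupport ξ →
      MemLp (fun z => ξ z * k z) 2 volume := fun {k ξ} hk hξ hξc => by
    have h1 := memLp_continuous_mul (hk _ hξc.isCompact) hξ hξc
    have h2 := (memLp_indicator_iff_restrict hξc.isCompact.measurableSet).2 h1
    refine (memLp_congr_ae (.of_forall fun z => ?_)).1 h2
    by_cases hz : z ∈ tsupport ξ
    · simp [hz]
    · simp [image_eq_zero_of_notMem_tsupport hz, hz]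
  obtain ⟨h4, h, hsm, hlim, hgrad⟩ := exists_smooth_approx (f := fun z => η z * f z)
    (f' := fun i z => η z * f' i z + pderiv i η z * f z)
    (hL2 hf.1 hη.continuous hηc) hηc.mul_right (fun i => (hf.2 i).1.contDiff_mul hη)
    (fun i => (hL2 (hf.2 i).2 hη.continuous hηc).add
      (hL2 hf.1 (contDiff_pderiv hη).continuous (hasCompactSupport_pderiv hηc)))
  have hKae : ∀ᵐ z ∂(volume.restrict K), z ∈ ball (0 : Plane) R := by
    filter_upwards [ae_restrict_mem hK.measurableSet] with z hz using hR hz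
  have e0 : (fun z => η z * f z) =ᵐ[volume.restrict K] f := by
    filter_upwards [hKae] with z hz
    simp [(hη1 z hz).eq_of_nhds]
  have e1 : ∀ i, (fun z => η z * f' i z + pderiv i η z * f z) =ᵐ[volume.restrict K] f' i :=
    fun i => by
      filter_upwards [hKae] with z hz
      rw [hη' i z hz, (hη1 z hz).eq_of_nhds]
      simp
  refine ⟨(memLp_congr_ae e0).1 (h4.restrict K), h, hsm, ?_, fun i => ?_⟩
  · refine tendsto_of_tendsto_of_tendsto_of_le_of_le tendsto_const_nhds hlim (fun _ => zero_le)
      fun n => ?_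
    refine (eLpNorm_congr_ae (e0.mono fun z hz =>
      congrArg (h n z - ·) hz.symm)).trans_le (eLpNorm_mono_measure _ Measure.restrict_le_self)
  · refine tendsto_of_tendsto_of_tendsto_of_le_of_le tendsto_const_nhds (hgrad i)
      (fun _ => zero_le) fun n => ?_
    refine (eLpNorm_congr_ae ((e1 i).mono fun z hz =>
      congrArg (pderiv i (h n) z - ·) hz.symm)).trans_le
      (eLpNorm_mono_measure _ Measure.restrict_le_self)

theorem IsWeakGrad.memL4loc {f : Plane → ℂ} {f' : Fin 2 → Plane → ℂ} (hf : IsWeakGrad f f') :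
    MemL4loc f := fun _ hK => (hf.exists_approx hK).1

end Approximation

section Products

/-- The exponents of `L⁴ · L⁴ ⊆ L²`. -/
instance holderTriple_four_four_two : ENNReal.HolderTriple 4 4 2 := ⟨by
  rw [← ENNReal.toReal_eq_toReal_iff' (by simp) (by simp), ENNReal.toReal_add (by simp) (by simp)]
  norm_num⟩

theorem MemL4loc.mul {f g : Plane → ℂ} (hf : MemL4loc f) (hg : MemL4loc g) :
    MemL2loc (fun z => f z * g z) := fun K hK => (hg K hK).mul' (hf K hK)

theorem MemL2loc.locallyIntegrable_mul {f g : Plane → ℂ} (hf : MemL2loc f) (hg : MemL2loc g) :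
    LocallyIntegrable (fun z => f z * g z) volume := by
  rw [locallyIntegrable_iff]
  intro K hK
  exact (hf K hK).integrable_mul (hg K hK)

theorem tendsto_integral_mul_of_L2 {μ : Measure Plane} {h : ℕ → Plane → ℂ} {f g : Plane → ℂ}
    (hm : ∀ n, AEStronglyMeasurable (h n) μ) (hf : MemLp f 2 μ) (hg : MemLp g 2 μ)
    (hlim : Tendsto (fun n => eLpNorm (h n - f) 2 μ) atTop (𝓝 0)) :
    Tendsto (fun n => ∫ z, h n z * g z ∂μ) atTop (𝓝 (∫ z, f z * g z ∂μ)) := by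
  refine tendsto_integral_of_L1' _ (hf.integrable_mul hg).1 ?_ ?_
  · filter_upwards [hlim.eventually (gt_mem_nhds ENNReal.zero_lt_top)] with n hn
    have h1 : MemLp (h n - f) 2 μ := ⟨(hm n).sub hf.1, hn⟩
    have h2 : MemLp (h n) 2 μ := by simpa using h1.add hf
    exact h2.integrable_mul hg
  · have h2 : Tendsto (fun n => eLpNorm (h n - f) 2 μ * eLpNorm g 2 μ) atTop
        (𝓝 (0 * eLpNorm g 2 μ)) := ENNReal.Tendsto.mul_const hlim (.inr hg.2.ne)
    rw [zero_mul] at h2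
    refine tendsto_of_tendsto_of_tendsto_of_le_of_le tendsto_const_nhds h2 (fun _ => zero_le)
      fun n => ?_
    refine le_trans (le_of_eq ?_) (eLpNorm_smul_le_mul_eLpNorm (p := 2) (q := 2) (r := 1) hg.1
      ((hm n).sub hf.1))
    congr 1
    funext z
    simp [sub_mul]

theorem tendsto_integral_mul_of_L4 {μ : Measure Plane} {h : ℕ → Plane → ℂ} {f p q : Plane → ℂ}
    (hm : ∀ n, AEStronglyMeasurable (h n) μ) (hf : MemLp f 4 μ) (hp : MemLp p 4 μ)
    (hq : MemLp q 2 μ) (hlim : Tendsto (fun n => eLpNorm (h n - f) 4 μ) atTop (𝓝 0)) :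
    Tendsto (fun n => ∫ z, h n z * (p z * q z) ∂μ) atTop (𝓝 (∫ z, f z * (p z * q z) ∂μ)) := by
  simp only [← mul_assoc]
  refine tendsto_integral_mul_of_L2 (h := fun n z => h n z * p z) (f := fun z => f z * p z)
    (fun n => (hm n).mul hp.1) (hp.mul' (p := 4) (q := 4) hf) hq ?_
  have h2 : Tendsto (fun n => eLpNorm (h n - f) 4 μ * eLpNorm p 4 μ) atTop
      (𝓝 (0 * eLpNorm p 4 μ)) := ENNReal.Tendsto.mul_const hlim (.inr hp.2.ne)
  rw [zero_mul] at h2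
  refine tendsto_of_tendsto_of_tendsto_of_le_of_le tendsto_const_nhds h2 (fun _ => zero_le)
    fun n => ?_
  refine le_trans (le_of_eq ?_) (eLpNorm_smul_le_mul_eLpNorm (p := 4) (q := 4) (r := 2) hp.1
    ((hm n).sub hf.1))
  congr 1
  funext z
  simp [sub_mul]

end Products

/-! ### Products of `H¹_loc` functions -/

section ProductRules

theorem pderiv_pderiv_comm {f : Plane → ℂ} (hf : ContDiff ℝ ∞ f) (i j : Fin 2) (z : Plane) :
    pderiv i (pderiv j f) z = pderiv j (pderiv i f) z := by
  have hs : IsSymmSndFDerivAt ℝ f z :=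
    (hf.contDiffAt (x := z)).isSymmSndFDerivAt
      (by simp only [minSmoothness_of_isRCLikeNormedField]; exact WithTop.coe_le_coe.2 le_top)
  have hd : DifferentiableAt ℝ (fderiv ℝ f) z :=
    (hf.fderiv_right (m := ∞) (by simp)).differentiable (by simp) z
  simp only [pderiv]
  rw [fderiv_clm_apply hd (differentiableAt_const _), fderiv_clm_apply hd (differentiableAt_const _)]
  simpa using hs.eq _ _

theorem memLp_restrict_of_continuous {F : Type*} [NormedAddCommGroup F] {p : ENNReal}
    {f : Plane → F} (hf : Continuous f)
    {K : Set Plane} (hK : IsCompact K) : MemLp f p (volume.restrict K) := by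
  have : IsFiniteMeasure (volume.restrict K) := ⟨by simpa using hK.measure_lt_top⟩
  obtain ⟨C, hC⟩ := hK.exists_bound_of_continuousOn hf.continuousOn
  exact .of_bound hf.aestronglyMeasurable C
    ((ae_restrict_mem hK.measurableSet).mono hC)

theorem memL4loc_of_continuous {f : Plane → ℂ} (hf : Continuous f) : MemL4loc f := fun _ hK =>
  memLp_restrict_of_continuous hf hK

/-- The integral of a function vanishing off `K` may be taken over `K`. -/
theorem integral_eq_setIntegral_tsupport {φ : Plane → ℝ} {F : Plane → ℂ}
    (h : ∀ z, z ∉ tsupport φ → F z = 0) : ∫ z, F z = ∫ z in tsupport φ, F z :=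
  (setIntegral_eq_integral_of_forall_compl_eq_zero h).symm

/-- Leibniz rule for the product of an `H¹_loc` function `h` with a function `w` that is only in
`L²_loc`. The weak derivative `w'` need not be in `L²_loc`: it is a sum of products of an `L⁴_loc` and
an `L²_loc` function, as is the derivative of a product of two `H¹_loc` functions, so that `h w'`
is still locally integrable and triple products are covered. -/
theorem IsWeakGrad.isWeakPartial_mul {i : Fin 2} {h w w' p₁ q₁ p₂ q₂ : Plane → ℂ}
    {h' : Fin 2 → Plane → ℂ} (hh : IsWeakGrad h h') (hw : IsWeakPartial i w w')
    (hw2 : MemL2loc w) (hp₁ : MemL4loc p₁) (hq₁ : MemL2loc q₁) (hp₂ : MemL4loc p₂)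
    (hq₂ : MemL2loc q₂) (hw' : ∀ z, w' z = p₁ z * q₁ z + p₂ z * q₂ z) :
    IsWeakPartial i (fun z => h z * w z) (fun z => h' i z * w z + h z * w' z) := by
  have e : ∀ z, h z * w' z = h z * p₁ z * q₁ z + h z * p₂ z * q₂ z := fun z => by rw [hw']; ring
  have hl : LocallyIntegrable (fun z => h' i z * w z + h z * w' z) volume := by
    simp only [e]
    exact ((hh.2 i).2.locallyIntegrable_mul hw2).add
      (((hh.memL4loc.mul hp₁).locallyIntegrable_mul hq₁).add
        ((hh.memL4loc.mul hp₂).locallyIntegrable_mul hq₂))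
  refine ⟨hh.1.locallyIntegrable_mul hw2, hl, fun φ hφ hc => ?_⟩
  set K := tsupport φ
  have hK : IsCompact K := hc
  obtain ⟨h4, g, hg, hg4, hg'⟩ := hh.exists_approx hK
  let ψ : Plane → ℂ := fun z => (φ z : ℂ)
  have hψ : ContDiff ℝ ∞ ψ := Complex.ofRealCLM.contDiff.comp hφ
  have hψc : HasCompactSupport ψ := hc.comp_left Complex.ofReal_zero
  have hψd : ∀ z, pderiv i ψ z = ((pderiv i φ z : ℝ) : ℂ) := pderiv_ofReal hφ
  have hdc := contDiff_pderiv (i := i) hψ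
  have v0 : ∀ z, z ∉ K → ψ z = 0 := fun z hz => by
    simp [ψ, image_eq_zero_of_notMem_tsupport hz]
  have v1 : ∀ z, z ∉ K → pderiv i ψ z = 0 := fun z hz => by
    rw [hψd]
    simp [pderiv, fderiv_of_notMem_tsupport (𝕜 := ℝ) hz]
  have hgm : ∀ n, AEStronglyMeasurable (g n) (volume.restrict K) := fun n =>
    (hg n).continuous.aestronglyMeasurable
  have hgm' : ∀ n, AEStronglyMeasurable (pderiv i (g n)) (volume.restrict K) := fun n =>
    (contDiff_pderiv (hg n)).continuous.aestronglyMeasurable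
  have hψ4 : ∀ {p}, MemL4loc p → MemLp (fun z => ψ z * p z) 4 (volume.restrict K) :=
    fun hp => memLp_continuous_mul (hp K hK) hψ.continuous hψc
  -- The limits of the terms of the rule for the smooth factors `g n`.
  have A := tendsto_integral_mul_of_L2 hgm' ((hh.2 i).2 K hK)
    (memLp_continuous_mul (hw2 K hK) hψ.continuous hψc) (hg' i)
  have B := tendsto_integral_mul_of_L4 hgm h4
    (memL4loc_of_continuous hdc.continuous K hK) (hw2 K hK) hg4
  have C₁ := tendsto_integral_mul_of_L4 hgm h4 (hψ4 hp₁) (hq₁ K hK) hg4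
  have C₂ := tendsto_integral_mul_of_L4 hgm h4 (hψ4 hp₂) (hq₂ K hK) hg4
  have hint : ∀ {k p q : Plane → ℂ}, MemLp k 4 (volume.restrict K) → MemLp p 4 (volume.restrict K) →
      MemLp q 2 (volume.restrict K) → Integrable (fun z => k z * (p z * q z)) (volume.restrict K) :=
    fun {k p q} hk hp hq => by
      have h1 : MemLp (fun z => k z * p z) 2 (volume.restrict K) := hp.mul' (p := 4) (q := 4) hk
      simpa only [← mul_assoc] using! h1.integrable_mul hq
  have hgK : ∀ n, MemLp (g n) 4 (volume.restrict K) := fun n =>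
    memL4loc_of_continuous (hg n).continuous K hK
  have step : ∀ n, (∫ z in K, pderiv i (g n) z * (ψ z * w z)) +
      (∫ z in K, g n z * (pderiv i ψ z * w z)) =
      -((∫ z in K, g n z * ((ψ z * p₁ z) * q₁ z)) + ∫ z in K, g n z * ((ψ z * p₂ z) * q₂ z)) :=
    fun n => by
      have key := hw.integral_pderiv_mul (hψ.mul (hg n)) (hψc.mul_right (f' := g n))
      have hd : ∀ z, pderiv i (fun z => ψ z * g n z) z =
          ψ z * pderiv i (g n) z + g n z * pderiv i ψ z := fun z =>
        pderiv_mul (hψ.differentiable (by simp) z) ((hg n).differentiable (by simp) z)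
      simp only [hd] at key
      rw [integral_eq_setIntegral_tsupport (φ := φ) fun z hz => by rw [v0 z hz, v1 z hz]; ring,
        integral_eq_setIntegral_tsupport (φ := φ) fun z hz => by rw [v0 z hz]; ring] at key
      rw [← integral_add, ← integral_add]
      · refine Eq.trans ?_ (key.trans ?_)
        · exact integral_congr_ae (.of_forall fun z => by ring)
        · congr 1
          exact integral_congr_ae (.of_forall fun z => by simp only [hw']; ring)
      · exact hint (hgK n) (hψ4 hp₁) (hq₁ K hK)
      · exact hint (hgK n) (hψ4 hp₂) (hq₂ K hK)
      · exact ((memL4loc_of_continuous (contDiff_pderiv (hg n)).continuous).mul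
          (memL4loc_of_continuous hψ.continuous) K hK).integrable_mul (hw2 K hK) |>.congr
          (.of_forall fun z => by simp only [Pi.mul_apply]; ring)
      · exact hint (hgK n) (memL4loc_of_continuous hdc.continuous K hK) (hw2 K hK)
  have lim := tendsto_nhds_unique ((A.add B).congr step) (C₁.add C₂).neg
  rw [integral_eq_setIntegral_tsupport (φ := φ) fun z hz => by
      have := v1 z hz
      rw [hψd, Complex.ofReal_eq_zero] at this
      simp only [pderiv] at this
      simp [this],
    integral_eq_setIntegral_tsupport (φ := φ) fun z hz => by
      simp [image_eq_zero_of_notMem_tsupport hz]]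
  have i1 : Integrable (fun z => h' i z * (ψ z * w z)) (volume.restrict K) :=
    ((hh.2 i).2 K hK).integrable_mul (memLp_continuous_mul (hw2 K hK) hψ.continuous hψc)
  have i2 : Integrable (fun z => h z * ((ψ z * p₁ z) * q₁ z) + h z * ((ψ z * p₂ z) * q₂ z))
      (volume.restrict K) := (hint h4 (hψ4 hp₁) (hq₁ K hK)).add (hint h4 (hψ4 hp₂) (hq₂ K hK))
  have r1 : ∫ z in K, φ z • (h' i z * w z + h z * w' z) =
      (∫ z in K, h' i z * (ψ z * w z)) +
        ((∫ z in K, h z * ((ψ z * p₁ z) * q₁ z)) + ∫ z in K, h z * ((ψ z * p₂ z) * q₂ z)) := by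
    rw [← integral_add (hint h4 (hψ4 hp₁) (hq₁ K hK)) (hint h4 (hψ4 hp₂) (hq₂ K hK)),
      ← integral_add i1 i2]
    exact integral_congr_ae (.of_forall fun z => by
      simp only [e, Complex.real_smul, ψ]; ring)
  have r2 : ∫ z in K, pderiv i φ z • (h z * w z) = ∫ z in K, h z * (pderiv i ψ z * w z) :=
    integral_congr_ae (.of_forall fun z => by simp only [hψd, Complex.real_smul]; ring)
  refine r2.trans ?_
  rw [r1]
  linear_combination lim

/-- The Jacobian `∂₀f ∂₁g - ∂₁f ∂₀g` of two `H¹_loc` functions is the weak curl of `f ∇g`. -/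
theorem IsWeakGrad.integral_jacobian {f g : Plane → ℂ} {f' g' : Fin 2 → Plane → ℂ}
    (hf : IsWeakGrad f f') (hg : IsWeakGrad g g') {φ : Plane → ℝ} (hφ : ContDiff ℝ ∞ φ)
    (hc : HasCompactSupport φ) :
    (∫ z, pderiv 0 φ z • (f z * g' 1 z)) - ∫ z, pderiv 1 φ z • (f z * g' 0 z) =
      - ∫ z, φ z • (f' 0 z * g' 1 z - f' 1 z * g' 0 z) := by
  set K := tsupport φ
  have hK : IsCompact K := hc
  obtain ⟨-, h, hh, -, hh'⟩ := hg.exists_approx hK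
  let ψ : Plane → ℂ := fun z => (φ z : ℂ)
  have hψ : ContDiff ℝ ∞ ψ := Complex.ofRealCLM.contDiff.comp hφ
  have hψc : HasCompactSupport ψ := hc.comp_left Complex.ofReal_zero
  have hψd : ∀ i z, pderiv i ψ z = ((pderiv i φ z : ℝ) : ℂ) := fun i => pderiv_ofReal hφ
  have hdc : ∀ i, Continuous (pderiv i ψ) := fun i => (contDiff_pderiv hψ).continuous
  have hdcc := fun i => hasCompactSupport_pderiv (i := i) hψc
  have v0 : ∀ z, z ∉ K → ψ z = 0 := fun z hz => by
    simp [ψ, image_eq_zero_of_notMem_tsupport hz]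
  have v1 : ∀ i z, z ∉ K → pderiv i ψ z = 0 := fun i z hz => by
    rw [hψd]
    simp [pderiv, fderiv_of_notMem_tsupport (𝕜 := ℝ) hz]
  have hd' : ∀ i n, ContDiff ℝ ∞ (pderiv i (h n)) := fun i n => contDiff_pderiv (hh n)
  have hm : ∀ i n, AEStronglyMeasurable (pderiv i (h n)) (volume.restrict K) := fun i n =>
    (hd' i n).continuous.aestronglyMeasurable
  have m1 : ∀ i, MemLp (fun z => pderiv i ψ z * f z) 2 (volume.restrict K) := fun i =>
    memLp_continuous_mul (hf.1 K hK) (hdc i) (hdcc i)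
  have m2 : ∀ i, MemLp (fun z => ψ z * f' i z) 2 (volume.restrict K) := fun i =>
    memLp_continuous_mul ((hf.2 i).2 K hK) hψ.continuous hψc
  have A := fun i j => tendsto_integral_mul_of_L2 (hm j) ((hg.2 j).2 K hK) (m1 i) (hh' j)
  have B := fun i j => tendsto_integral_mul_of_L2 (hm j) ((hg.2 j).2 K hK) (m2 i) (hh' j)
  have hin : ∀ (k : Plane → ℂ), Continuous k → ∀ {q}, MemLp q 2 (volume.restrict K) →
      Integrable (fun z => k z * q z) (volume.restrict K) := fun k hk q hq =>
    (memLp_restrict_of_continuous (p := 2) hk hK).integrable_mul hq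
  -- Integration by parts in `f`, tested against `φ ∂ⱼh`, where `h` is smooth.
  have parts : ∀ i j n, (∫ z in K, pderiv j (h n) z * (pderiv i ψ z * f z)) +
      (∫ z in K, pderiv i (pderiv j (h n)) z * (ψ z * f z)) =
      - ∫ z in K, pderiv j (h n) z * (ψ z * f' i z) := fun i j n => by
    have key := (hf.2 i).1.integral_pderiv_mul (hψ.mul (hd' j n))
      (hψc.mul_right (f' := pderiv j (h n)))
    have hd : ∀ z, pderiv i (fun z => ψ z * pderiv j (h n) z) z =
        ψ z * pderiv i (pderiv j (h n)) z + pderiv j (h n) z * pderiv i ψ z := fun z =>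
      pderiv_mul (hψ.differentiable (by simp) z) ((hd' j n).differentiable (by simp) z)
    simp only [hd] at key
    rw [integral_eq_setIntegral_tsupport (φ := φ) fun z hz => by rw [v0 z hz, v1 i z hz]; ring,
      integral_eq_setIntegral_tsupport (φ := φ) fun z hz => by rw [v0 z hz]; ring] at key
    rw [← integral_add]
    · refine Eq.trans ?_ (key.trans ?_)
      · exact integral_congr_ae (.of_forall fun z => by ring)
      · congr 1
        exact integral_congr_ae (.of_forall fun z => by ring)
    · exact hin _ (hd' j n).continuous (m1 i)
    · exact hin _ (contDiff_pderiv (hd' j n)).continuous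
        (memLp_continuous_mul (hf.1 K hK) hψ.continuous hψc)
  -- The mixed second derivatives of `h n` cancel in the difference.
  have step : ∀ n, (∫ z in K, pderiv 1 (h n) z * (pderiv 0 ψ z * f z)) -
      (∫ z in K, pderiv 0 (h n) z * (pderiv 1 ψ z * f z)) =
      -((∫ z in K, pderiv 1 (h n) z * (ψ z * f' 0 z)) -
        ∫ z in K, pderiv 0 (h n) z * (ψ z * f' 1 z)) := fun n => by
    have h1 := parts 0 1 n
    have h2 := parts 1 0 n
    simp only [pderiv_pderiv_comm (hh n) 1 0] at h2
    linear_combination h1 - h2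
  have lim := tendsto_nhds_unique (((A 0 1).sub (A 1 0)).congr step) ((B 0 1).sub (B 1 0)).neg
  have r : ∀ i j, ∫ z, pderiv i φ z • (f z * g' j z) =
      ∫ z in K, g' j z * (pderiv i ψ z * f z) := fun i j => by
    rw [integral_eq_setIntegral_tsupport (φ := φ) fun z hz => by
      have := v1 i z hz
      rw [hψd, Complex.ofReal_eq_zero] at this
      simp only [this, zero_smul]]
    exact integral_congr_ae (.of_forall fun z => by
      simp only [hψd, Complex.real_smul]; ring)
  rw [r 0 1, r 1 0, integral_eq_setIntegral_tsupport (φ := φ) fun z hz => by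
      simp [image_eq_zero_of_notMem_tsupport hz], lim, ← integral_sub]
  · congr 1
    exact integral_congr_ae (.of_forall fun z => by simp only [Complex.real_smul, ψ]; ring)
  · exact ((hg.2 1).2 K hK).integrable_mul (m2 0)
  · exact ((hg.2 0).2 K hK).integrable_mul (m2 1)

end ProductRules

/-! ### Means of lattice-periodic functions -/

section Periodic

variable {F : Type*} {L : Submodule ℤ Plane}

theorem quasiMeasurePreserving_add (v : Plane) :
    Measure.QuasiMeasurePreserving (fun z : Plane => z + v) volume volume :=
  (measurePreserving_add_right volume v).quasiMeasurePreserving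

theorem ae_periodic_of_basis (b : Module.Basis (Fin 2) ℤ L) {f : Plane → F}
    (h : ∀ j, ∀ᵐ z : Plane, f (z + (b j : Plane)) = f z) (v : L) :
    ∀ᵐ z : Plane, f (z + (v : Plane)) = f z := by
  let S : AddSubgroup L :=
    { carrier := {v | ∀ᵐ z : Plane, f (z + (v : Plane)) = f z}
      zero_mem' := by simp
      add_mem' := fun {v w} hv hw => by
        simp only [Set.mem_ofPred_eq] at hv hw ⊢
        filter_upwards [hv, (quasiMeasurePreserving_add (v : Plane)).ae hw] with z h1 h2
        rw [Submodule.coe_add, ← add_assoc, h2, h1]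
      neg_mem' := fun {v} hv => by
        simp only [Set.mem_ofPred_eq] at hv ⊢
        filter_upwards [(quasiMeasurePreserving_add (-v : Plane)).ae hv] with z h1
        rw [Submodule.coe_neg, ← h1, neg_add_cancel_right] }
  have hle : Submodule.span ℤ (Set.range b) ≤ AddSubgroup.toIntSubmodule S :=
    Submodule.span_le.2 (by rintro _ ⟨j, rfl⟩; exact h j)
  have hv : v ∈ Submodule.span ℤ (Set.range b) := by rw [b.span_eq]; trivial
  exact hle hv

/-- Lebesgue measure is invariant under the action of a lattice given as a `ℤ`-submodule. -/
instance vaddInvariantMeasure_submodule : VAddInvariantMeasure L Plane volume :=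
  inferInstanceAs (VAddInvariantMeasure L.toAddSubgroup Plane volume)

variable [NormedAddCommGroup F]

open Classical in
/-- A function that is periodic up to null sets has an exactly periodic representative. -/
theorem exists_periodic_representative [Countable L] {f : Plane → F}
    (h : ∀ v : L, ∀ᵐ z : Plane, f (z + (v : Plane)) = f z) :
    ∃ g : Plane → F, f =ᵐ[volume] g ∧ ∀ (v : L) z, g (v +ᵥ z) = g z := by
  refine ⟨fun z => if ∀ v : L, f (z + (v : Plane)) = f z then f z else 0, ?_, fun v z => ?_⟩
  · filter_upwards [ae_all_iff.2 h] with z hz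
    rw [if_pos hz]
  · have e : v +ᵥ z = z + (v : Plane) := add_comm _ _
    simp only [e]
    by_cases hz : ∀ w : L, f (z + (w : Plane)) = f z
    · have hz' : ∀ w : L, f (z + (v : Plane) + (w : Plane)) = f (z + (v : Plane)) := fun w => by
        rw [hz v, add_assoc, ← Submodule.coe_add, hz]
      rw [if_pos hz, if_pos hz', hz]
    · rw [if_neg hz, if_neg]
      intro hz'
      refine hz fun w => ?_
      have h1 := hz' (w - v)
      have h2 := hz' (-v)
      rw [Submodule.coe_neg, add_neg_cancel_right] at h2
      rw [Submodule.coe_sub, add_assoc, add_sub_cancel] at h1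
      rw [h1, h2]

variable [DiscreteTopology L] [IsZLattice ℝ L] {Ω : Set Plane}

theorem exists_isBounded_fundamentalDomain (b : Module.Basis (Fin 2) ℤ L) :
    ∃ D : Set Plane, MeasurableSet D ∧ Bornology.IsBounded D ∧
      IsAddFundamentalDomain L D volume :=
  ⟨_, ZSpan.fundamentalDomain_measurableSet (b.ofZLatticeBasis ℝ L),
    ZSpan.fundamentalDomain_isBounded _, ZLattice.isAddFundamentalDomain b volume⟩

theorem integrableOn_of_isBounded {f : Plane → F} (hf : LocallyIntegrable f volume) {D : Set Plane}
    (hD : Bornology.IsBounded D) : IntegrableOn f D volume :=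
  (hf.integrableOn_isCompact hD.isCompact_closure).mono_set subset_closure

theorem integrableOn_of_periodic (b : Module.Basis (Fin 2) ℤ L)
    (hΩ : IsAddFundamentalDomain L Ω volume) {f : Plane → F} (hf : LocallyIntegrable f volume)
    (hp : ∀ v : L, ∀ᵐ z : Plane, f (z + (v : Plane)) = f z) : IntegrableOn f Ω volume := by
  obtain ⟨D, -, hDb, hD⟩ := exists_isBounded_fundamentalDomain b
  obtain ⟨g, hfg, hg⟩ := exists_periodic_representative hp
  have h1 : IntegrableOn g D volume :=
    (integrableOn_of_isBounded hf hDb).congr (ae_restrict_of_ae hfg)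
  exact ((hΩ.integrableOn_iff hD hg).2 h1).congr (ae_restrict_of_ae hfg.symm)

variable [NormedSpace ℝ F]

/-- The mean of a periodic function over a fundamental domain is invariant under translations of
the function and does not depend on the domain. -/
theorem setIntegral_sub_eq_of_periodic (hΩ : IsAddFundamentalDomain L Ω volume) {D : Set Plane}
    (hD : IsAddFundamentalDomain L D volume) {f : Plane → F}
    (hp : ∀ v : L, ∀ᵐ z : Plane, f (z + (v : Plane)) = f z) (y : Plane) :
    ∫ x in D, f (x - y) = ∫ x in Ω, f x := by
  obtain ⟨g, hfg, hg⟩ := exists_periodic_representative hp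
  have h1 : ∫ x in D, f (x - y) = ∫ x in D, g (x - y) := by
    refine integral_congr_ae (ae_restrict_of_ae ?_)
    simpa only [sub_eq_add_neg] using (quasiMeasurePreserving_add (-y)).ae hfg
  have h2 : IsAddFundamentalDomain L ((-y) +ᵥ D) volume := hD.vadd_of_comm (-y)
  rw [h1, integral_congr_ae (ae_restrict_of_ae hfg), hΩ.setIntegral_eq h2 hg]
  have h3 := (measurePreserving_vadd (-y) (volume : Measure Plane)).setIntegral_image_emb
    (measurableEmbedding_const_vadd (-y)) g D
  rw [show ((-y) +ᵥ D : Set Plane) = (fun x => (-y) +ᵥ x) '' D from rfl, h3]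
  simp only [vadd_eq_add, neg_add_eq_sub]

/-- Averaging `η ⋆ f` over a fundamental domain gives `∫ η` times the mean of `f`. -/
theorem setIntegral_convolution_of_periodic (hΩ : IsAddFundamentalDomain L Ω volume) {D : Set Plane}
    (hDm : MeasurableSet D) (hDb : Bornology.IsBounded D) (hD : IsAddFundamentalDomain L D volume)
    {f : Plane → F} (hf : LocallyIntegrable f volume)
    (hp : ∀ v : L, ∀ᵐ z : Plane, f (z + (v : Plane)) = f z) {η : Plane → ℝ} (hη : Continuous η)
    (hc : HasCompactSupport η) [CompleteSpace F] :
    ∫ x in D, ∫ y, η (x - y) • f y = (∫ y, η y) • ∫ x in Ω, f x := by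
  obtain ⟨R, hR⟩ := hDb.subset_closedBall (0 : Plane)
  obtain ⟨S, hS⟩ := hc.isCompact.isBounded.subset_closedBall (0 : Plane)
  let B : Set Plane := closedBall 0 (R + S)
  have hB : MeasurableSet B := measurableSet_closedBall
  have hfB : Integrable (B.indicator f) volume :=
    (integrable_indicator_iff hB).2 (hf.integrableOn_isCompact (isCompact_closedBall _ _))
  have hind : ∀ x ∈ D, ∀ y, η y • f (x - y) = η y • B.indicator f (x - y) := fun x hx y => by
    by_cases hy : η y = 0
    · simp [hy]
    · have hy' := mem_closedBall_zero_iff.1 (hS (subset_tsupport η hy))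
      have hx' := mem_closedBall_zero_iff.1 (hR hx)
      rw [Set.indicator_of_mem]
      rw [mem_closedBall_zero_iff]
      linarith [norm_sub_le x y]
  have hint : Integrable (fun p : Plane × Plane => η p.2 • B.indicator f (p.1 - p.2))
      ((volume.restrict D).prod volume) := by
    have h1 := (hη.integrable_of_hasCompactSupport hc (μ := volume)).convolution_integrand
      (lsmul ℝ ℝ) hfB
    have h2 := h1.integrableOn (s := D ×ˢ Set.univ)
    rw [IntegrableOn, ← Measure.prod_restrict, Measure.restrict_univ] at h2
    exact h2
  calc ∫ x in D, ∫ y, η (x - y) • f y = ∫ x in D, ∫ y, η y • B.indicator f (x - y) := by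
        refine setIntegral_congr_fun hDm fun x hx => ?_
        rw [← integral_sub_left_eq_self _ volume x]
        refine integral_congr_ae (.of_forall fun y => ?_)
        simp only [sub_sub_cancel]
        exact hind x hx y
    _ = ∫ y, ∫ x in D, η y • B.indicator f (x - y) := integral_integral_swap hint
    _ = ∫ y, η y • ∫ x in Ω, f x := by
        refine integral_congr_ae (.of_forall fun y => ?_)
        beta_reduce
        rw [← setIntegral_sub_eq_of_periodic hΩ hD hp y, ← integral_smul]
        exact setIntegral_congr_fun hDm fun x hx => (hind x hx y).symm
    _ = _ := integral_smul_const _ _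

theorem integral_pderiv_eq_zero {i : Fin 2} {φ : Plane → ℝ} (hφ : ContDiff ℝ ∞ φ)
    (hc : HasCompactSupport φ) : ∫ z, pderiv i φ z = 0 := by
  have h : IsWeakPartial i (fun _ : Plane => (1 : ℝ)) _ := .of_contDiff contDiff_const
  have := h.2.2 φ hφ hc
  simpa [pderiv] using this

/-- A periodic function that is the weak divergence of a periodic vector field has mean zero. -/
theorem setIntegral_eq_zero_of_weak_divergence [CompleteSpace F] (b : Module.Basis (Fin 2) ℤ L)
    (hΩ : IsAddFundamentalDomain L Ω volume) {f g₀ g₁ : Plane → F}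
    (hf : LocallyIntegrable f volume) (hg₀ : LocallyIntegrable g₀ volume)
    (hg₁ : LocallyIntegrable g₁ volume)
    (hpf : ∀ v : L, ∀ᵐ z : Plane, f (z + (v : Plane)) = f z)
    (hp₀ : ∀ v : L, ∀ᵐ z : Plane, g₀ (z + (v : Plane)) = g₀ z)
    (hp₁ : ∀ v : L, ∀ᵐ z : Plane, g₁ (z + (v : Plane)) = g₁ z)
    (h : ∀ φ : Plane → ℝ, ContDiff ℝ ∞ φ → HasCompactSupport φ →
      ∫ z, φ z • f z = - ((∫ z, pderiv 0 φ z • g₀ z) + ∫ z, pderiv 1 φ z • g₁ z)) :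
    ∫ z in Ω, f z = 0 := by
  obtain ⟨D, hDm, hDb, hD⟩ := exists_isBounded_fundamentalDomain b
  -- The hypothesis is tested against `t ↦ r (x - t)` for every `x` and then averaged over `D`.
  let ρ : ContDiffBump (0 : Plane) := ⟨1, 2, one_pos, one_lt_two⟩
  set r : Plane → ℝ := ρ.normed volume with hr
  have hrs : ContDiff ℝ ∞ r := ρ.contDiff_normed
  have hrc : HasCompactSupport r := ρ.hasCompactSupport_normed
  have key : ∀ x, ∫ y, r (x - y) • f y =
      (∫ y, pderiv 0 r (x - y) • g₀ y) + ∫ y, pderiv 1 r (x - y) • g₁ y := fun x => by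
    have hdφ := fun i => pderiv_comp_sub_left (hrs.differentiable (by simp)) i x
    have := h _ (hrs.comp (contDiff_const.sub contDiff_id))
      (hrc.comp_homeomorph (Homeomorph.subLeft x))
    refine this.trans ?_
    have e : ∀ i, ∀ g : Plane → F, ∫ y, pderiv i (fun t => r (x - t)) y • g y =
        - ∫ y, pderiv i r (x - y) • g y := fun i g => by
      simp only [hdφ, neg_smul, integral_neg]
    exact (congrArg₂ (fun a b => -(a + b)) (e 0 g₀) (e 1 g₁)).trans (by abel)
  have hdc : ∀ i, Continuous (pderiv i r) := fun i => (contDiff_pderiv hrs).continuous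
  have hdcc : ∀ i, HasCompactSupport (pderiv i r) := fun i => hasCompactSupport_pderiv hrc
  have I : ∀ {g : Plane → F} {η : Plane → ℝ}, LocallyIntegrable g volume → Continuous η →
      HasCompactSupport η → IntegrableOn (fun x => ∫ y, η (x - y) • g y) D volume :=
    fun {g η} hg hη hηc => by
      have h1 : Continuous (η ⋆[lsmul ℝ ℝ, volume] g) :=
        hηc.continuous_convolution_left _ hη hg
      have h2 : (η ⋆[lsmul ℝ ℝ, volume] g) = fun x => ∫ y, η (x - y) • g y := by
        funext x
        rw [convolution_eq_swap]
        rfl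
      rw [← h2]
      exact integrableOn_of_isBounded h1.locallyIntegrable hDb
  have h1 := setIntegral_convolution_of_periodic hΩ hDm hDb hD hf hpf hrs.continuous hrc
  simp only [key] at h1
  rw [integral_add (I hg₀ (hdc 0) (hdcc 0)) (I hg₁ (hdc 1) (hdcc 1)),
    setIntegral_convolution_of_periodic hΩ hDm hDb hD hg₀ hp₀ (hdc 0) (hdcc 0),
    setIntegral_convolution_of_periodic hΩ hDm hDb hD hg₁ hp₁ (hdc 1) (hdcc 1),
    integral_pderiv_eq_zero hrs hrc, integral_pderiv_eq_zero hrs hrc, hr, ρ.integral_normed] at h1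
  simpa using h1.symm

end Periodic

/-! ### Covariant derivatives and the weak curl of the current -/

section Configuration

variable {F : Type*} [NormedAddCommGroup F]

theorem memL2loc_of_continuous {f : Plane → F} (hf : Continuous f) : MemL2loc f := fun _ hK =>
  memLp_restrict_of_continuous hf hK

theorem MemL2loc.locallyIntegrable {f : Plane → F} (hf : MemL2loc f) :
    LocallyIntegrable f volume := by
  rw [locallyIntegrable_iff]
  intro K hK
  have : IsFiniteMeasure (volume.restrict K) := ⟨by simpa using hK.measure_lt_top⟩
  exact (hf K hK).integrable one_le_two

theorem MemL2loc.locallyIntegrable_norm_sq {f : Plane → F} (hf : MemL2loc f) :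
    LocallyIntegrable (fun z => ‖f z‖ ^ 2) volume := by
  rw [locallyIntegrable_iff]
  exact fun K hK => (hf K hK).integrable_norm_pow two_ne_zero

variable [NormedSpace ℝ F]

theorem MemH1loc.weakPartial_spec [CompleteSpace F] {f : Plane → F} (hf : MemH1loc f) (i : Fin 2) :
    IsWeakPartial i f (weakPartial i f) ∧ MemL2loc (weakPartial i f) := by
  obtain ⟨g, hg, hg2⟩ := hf.2 i
  have h := hg.weakPartial_ae_eq
  exact ⟨hg.congr .rfl h.symm, fun K hK => (memLp_congr_ae (ae_restrict_of_ae h)).2 (hg2 K hK)⟩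

theorem MemH1loc.add {f g : Plane → F} (hf : MemH1loc f) (hg : MemH1loc g) :
    MemH1loc (f + g) :=
  ⟨fun K hK => (hf.1 K hK).add (hg.1 K hK), fun i => by
    obtain ⟨f', h1, h2⟩ := hf.2 i
    obtain ⟨g', h3, h4⟩ := hg.2 i
    exact ⟨f' + g', h1.add h3, fun K hK => (h2 K hK).add (h4 K hK)⟩⟩

theorem MemH1loc.of_contDiff {f : Plane → F} (hf : ContDiff ℝ 1 f) : MemH1loc f :=
  ⟨memL2loc_of_continuous hf.continuous, fun _ => ⟨_, IsWeakPartial.of_contDiff hf,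
    memL2loc_of_continuous (continuous_pderiv hf)⟩⟩

/-- The `j`-th component of `A₀` as a continuous linear form. -/
noncomputable def A0form (j : Fin 2) : Plane →L[ℝ] ℝ :=
  if j = 0 then -(Real.pi • EuclideanSpace.proj (𝕜 := ℝ) (1 : Fin 2))
  else Real.pi • EuclideanSpace.proj (𝕜 := ℝ) (0 : Fin 2)

theorem A0_apply (z : Plane) (j : Fin 2) : A0 z j = A0form j z := by
  fin_cases j <;> simp [A0, A0form]

/-- The linear map `z ↦ π (v_x y - v_y x)`, the phase of the multiplier of the translation `v`. -/
noncomputable def phase (v : Plane) : Plane →L[ℝ] ℝ :=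
  Real.pi • (v 0 • EuclideanSpace.proj (𝕜 := ℝ) (1 : Fin 2) -
    v 1 • EuclideanSpace.proj (𝕜 := ℝ) (0 : Fin 2))

theorem phase_single (v : Plane) (j : Fin 2) :
    phase v (EuclideanSpace.single j 1) = A0 v j := by
  fin_cases j <;> simp [phase, A0]

/-- The multiplier `exp (iπ (v_x y - v_y x))` of the translation `v`. -/
noncomputable def multiplier (v z : Plane) : ℂ := Complex.exp (Complex.I * (phase v z : ℝ))

theorem contDiff_multiplier (v : Plane) : ContDiff ℝ ∞ (multiplier v) :=
  (contDiff_const.mul (Complex.ofRealCLM.contDiff.comp (phase v).contDiff)).cexp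

theorem pderiv_multiplier (v z : Plane) (j : Fin 2) :
    pderiv j (multiplier v) z = Complex.I * (A0 v j : ℝ) * multiplier v z := by
  have h1 : HasFDerivAt (fun z => ((phase v z : ℝ) : ℂ)) (Complex.ofRealCLM.comp (phase v)) z :=
    (Complex.ofRealCLM.comp (phase v)).hasFDerivAt
  have h2 := (h1.const_mul Complex.I).cexp
  have h3 : fderiv ℝ (multiplier v) z = _ := h2.fderiv
  simp only [pderiv, h3]
  simp [phase_single, multiplier]
  ring

theorem conj_multiplier_mul (v z : Plane) : conj (multiplier v z) * multiplier v z = 1 := by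
  rw [multiplier, ← Complex.exp_conj, ← Complex.exp_add]
  simp

theorem norm_multiplier (v z : Plane) : ‖multiplier v z‖ = 1 := by
  rw [multiplier, mul_comm]
  exact Complex.norm_exp_ofReal_mul_I _

theorem IsWeakPartial.conj {i : Fin 2} {f g : Plane → ℂ} (h : IsWeakPartial i f g) :
    IsWeakPartial i (fun z => conj (f z)) (fun z => conj (g z)) :=
  h.clm_comp Complex.conjCLE.toContinuousLinearMap

/-- The covariant derivative `∂ⱼu - i Cⱼ u`. -/
noncomputable def covDeriv (C : Plane → Plane) (u : Plane → ℂ) (j : Fin 2) : Plane → ℂ := fun z =>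
  weakPartial j u z - Complex.I * ((C z j : ℝ) : ℂ) * u z

theorem norm_covGrad (C : Plane → Plane) (u : Plane → ℂ) (j : Fin 2) (z : Plane) :
    ‖covGrad C u j z‖ = ‖covDeriv C u j z‖ := by
  have : covGrad C u j z = Complex.I * covDeriv C u j z := by
    simp only [covGrad, covDeriv]
    linear_combination ((C z j : ℝ) : ℂ) * u z * Complex.I_sq
  rw [this, norm_mul, Complex.norm_I, one_mul]

theorem Dplus_eq (C : Plane → Plane) (u : Plane → ℂ) (z : Plane) :
    Dplus C u z = covDeriv C u 0 z + Complex.I * covDeriv C u 1 z := by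
  simp only [Dplus, covDeriv]
  linear_combination ((C z 1 : ℝ) : ℂ) * u z * Complex.I_sq

/-- `i` times the curl of the current `Im (ū Du)`, in the form in which it appears in the
Bogomolny identity: `conj (D₀u) D₁u - conj (D₁u) D₀u - i (curl C) |u|²`. -/
noncomputable def currentCurl (C : Plane → Plane) (u : Plane → ℂ) : Plane → ℂ := fun z =>
  conj (covDeriv C u 0 z) * covDeriv C u 1 z - conj (covDeriv C u 1 z) * covDeriv C u 0 z -
    Complex.I * ((curl C z : ℝ) : ℂ) * (conj (u z) * u z)

/-- The pointwise completion of the square. -/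
theorem norm_Dplus_sq (C : Plane → Plane) (u : Plane → ℂ) (z : Plane) :
    ‖Dplus C u z‖ ^ 2 = ‖covDeriv C u 0 z‖ ^ 2 + ‖covDeriv C u 1 z‖ ^ 2 -
      (currentCurl C u z).im - curl C z * ‖u z‖ ^ 2 := by
  rw [Dplus_eq, currentCurl]
  simp only [← Complex.normSq_eq_norm_sq, Complex.normSq_apply, Complex.add_re, Complex.add_im,
    Complex.mul_re, Complex.mul_im, Complex.sub_im, Complex.conj_re, Complex.conj_im, Complex.I_re,
    Complex.I_im, Complex.ofReal_re, Complex.ofReal_im]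
  ring

variable {u : Plane → ℂ} {C : Plane → Plane}

theorem MemH1loc.isWeakGrad (hu : MemH1loc u) : IsWeakGrad u (fun i => weakPartial i u) :=
  ⟨hu.1, hu.weakPartial_spec⟩

theorem MemH1loc.isWeakGrad_conj (hu : MemH1loc u) :
    IsWeakGrad (fun z => conj (u z)) (fun i z => conj (weakPartial i u z)) :=
  ⟨fun K hK => (hu.1 K hK).star, fun i =>
    ⟨(hu.weakPartial_spec i).1.conj, fun K hK => ((hu.weakPartial_spec i).2 K hK).star⟩⟩

theorem MemH1loc.isWeakGrad_ofReal {f : Plane → ℝ} (hf : MemH1loc f) :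
    IsWeakGrad (fun z => (f z : ℂ)) (fun i z => ((weakPartial i f z : ℝ) : ℂ)) :=
  ⟨fun K hK => (hf.1 K hK).ofReal, fun i =>
    ⟨(hf.weakPartial_spec i).1.clm_comp Complex.ofRealCLM,
      fun K hK => ((hf.weakPartial_spec i).2 K hK).ofReal⟩⟩

theorem memL2loc_covDeriv (hu : MemH1loc u) (hC : ∀ j, MemH1loc (fun z => C z j)) (j : Fin 2) :
    MemL2loc (covDeriv C u j) := fun K hK => by
  have h1 := ((hC j).isWeakGrad_ofReal.memL4loc.mul hu.isWeakGrad.memL4loc K hK).const_mul Complex.I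
  have h2 := ((hu.weakPartial_spec j).2 K hK).sub h1
  refine (memLp_congr_ae (.of_forall fun z => ?_)).1 h2
  simp only [Pi.sub_apply, covDeriv, mul_assoc]

theorem memL2loc_normSq (hu : MemH1loc u) : MemL2loc (fun z => conj (u z) * u z) :=
  hu.isWeakGrad_conj.memL4loc.mul hu.isWeakGrad.memL4loc

theorem memL2loc_curl (hC : ∀ j, MemH1loc (fun z => C z j)) : MemL2loc (curl C) := fun K hK =>
  (((hC 1).weakPartial_spec 0).2 K hK).sub (((hC 0).weakPartial_spec 1).2 K hK)

theorem locallyIntegrable_currentCurl (hu : MemH1loc u) (hC : ∀ j, MemH1loc (fun z => C z j)) :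
    LocallyIntegrable (currentCurl C u) volume := by
  have hD := memL2loc_covDeriv hu hC
  have hDc : ∀ j, MemL2loc (fun z => conj (covDeriv C u j z)) := fun j K hK => (hD j K hK).star
  have hc : MemL2loc (fun z => Complex.I * ((curl C z : ℝ) : ℂ)) := fun K hK =>
    ((memL2loc_curl hC K hK).ofReal).const_mul _
  exact (((hDc 0).locallyIntegrable_mul (hD 1)).sub ((hDc 1).locallyIntegrable_mul (hD 0))).sub
    (hc.locallyIntegrable_mul (memL2loc_normSq hu))

theorem locallyIntegrable_current (hu : MemH1loc u) (hC : ∀ j, MemH1loc (fun z => C z j))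
    (j : Fin 2) : LocallyIntegrable (fun z => conj (u z) * covDeriv C u j z) volume :=
  MemL2loc.locallyIntegrable_mul (fun K hK => (hu.1 K hK).star) (memL2loc_covDeriv hu hC j)

/-- `currentCurl` is the weak curl of `ū Du`. -/
theorem integral_smul_currentCurl (hu : MemH1loc u) (hC : ∀ j, MemH1loc (fun z => C z j))
    {φ : Plane → ℝ} (hφ : ContDiff ℝ ∞ φ) (hc : HasCompactSupport φ) :
    ∫ z, φ z • currentCurl C u z =
      - ((∫ z, pderiv 0 φ z • (conj (u z) * covDeriv C u 1 z)) +
        ∫ z, pderiv 1 φ z • (-(conj (u z) * covDeriv C u 0 z))) := by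
  have gu := hu.isWeakGrad
  have gc := hu.isWeakGrad_conj
  have gC := fun j => (hC j).isWeakGrad_ofReal
  have hone : MemL4loc (fun _ => (1 : ℂ)) := memL4loc_of_continuous continuous_const
  have hzero : MemL4loc (fun _ => (0 : ℂ)) := memL4loc_of_continuous continuous_const
  -- The weak derivatives of `|u|²` and of `C_j |u|²`.
  have W : ∀ i, IsWeakPartial i (fun z => conj (u z) * u z)
      (fun z => conj (weakPartial i u z) * u z + conj (u z) * weakPartial i u z) := fun i =>
    gc.isWeakPartial_mul (gu.2 i).1 gu.1 hone (gu.2 i).2 hzero gu.1 (fun z => by ring)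
  have CW := fun i j => (gC j).isWeakPartial_mul (W i) (memL2loc_normSq hu) gu.memL4loc (gc.2 i).2
    gc.memL4loc (gu.2 i).2 (fun z => by ring)
  have J := gc.integral_jacobian gu hφ hc
  have E := fun i j => (CW i j).2.2 φ hφ hc
  have hdc : ∀ i, Continuous (pderiv i φ) := fun i => (contDiff_pderiv hφ).continuous
  have hdcc : ∀ i, HasCompactSupport (pderiv i φ) := fun i => hasCompactSupport_pderiv hc
  have T : ∀ {f : Plane → ℂ}, LocallyIntegrable f volume → Integrable (fun z => φ z • f z) :=
    fun hf => hf.integrable_smul_left_of_hasCompactSupport hφ.continuous hc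
  have T' : ∀ {f : Plane → ℂ} (i), LocallyIntegrable f volume →
      Integrable (fun z => pderiv i φ z • f z) :=
    fun i hf => hf.integrable_smul_left_of_hasCompactSupport (hdc i) (hdcc i)
  have lJ : LocallyIntegrable (fun z => conj (weakPartial 0 u z) * weakPartial 1 u z -
      conj (weakPartial 1 u z) * weakPartial 0 u z) volume :=
    ((gc.2 0).2.locallyIntegrable_mul (gu.2 1).2).sub
      ((gc.2 1).2.locallyIntegrable_mul (gu.2 0).2)
  have comb : ∀ {f g k : Plane → ℂ}, Integrable f → Integrable g → Integrable k →
      ∫ z, (f z - Complex.I * g z + Complex.I * k z) =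
        (∫ z, f z) - Complex.I * (∫ z, g z) + Complex.I * ∫ z, k z := fun {f g k} hf hg hk => by
    have h1 : Integrable (fun z => f z - Complex.I * g z) := hf.sub (hg.const_mul _)
    rw [integral_add h1 (hk.const_mul _), integral_sub hf (hg.const_mul _),
      integral_const_mul, integral_const_mul]
  have lhs : ∫ z, φ z • currentCurl C u z =
      (∫ z, φ z • (conj (weakPartial 0 u z) * weakPartial 1 u z -
        conj (weakPartial 1 u z) * weakPartial 0 u z)) -
      Complex.I * (∫ z, φ z • (((weakPartial 0 (fun w => C w 1) z : ℝ) : ℂ) * (conj (u z) * u z) +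
        ((C z 1 : ℝ) : ℂ) *
          (conj (weakPartial 0 u z) * u z + conj (u z) * weakPartial 0 u z))) +
      Complex.I * (∫ z, φ z • (((weakPartial 1 (fun w => C w 0) z : ℝ) : ℂ) * (conj (u z) * u z) +
        ((C z 0 : ℝ) : ℂ) *
          (conj (weakPartial 1 u z) * u z + conj (u z) * weakPartial 1 u z))) := by
    rw [← comb (T lJ) (T (CW 0 1).2.1) (T (CW 1 0).2.1)]
    refine integral_congr_ae (.of_forall fun z => ?_)
    simp only [currentCurl, covDeriv, curl, Complex.real_smul, map_sub, map_mul, Complex.conj_I,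
      Complex.conj_ofReal, Complex.ofReal_sub]
    ring_nf
  have rhs : ∀ i j, ∫ z, pderiv i φ z • (conj (u z) * covDeriv C u j z) =
      (∫ z, pderiv i φ z • (conj (u z) * weakPartial j u z)) -
      Complex.I * ∫ z, pderiv i φ z • (((C z j : ℝ) : ℂ) * (conj (u z) * u z)) := fun i j => by
    rw [← integral_const_mul, ← integral_sub (T' i (gc.1.locallyIntegrable_mul (gu.2 j).2))
      ((T' i (CW 0 j).1).const_mul _)]
    refine integral_congr_ae (.of_forall fun z => ?_)
    simp only [covDeriv, Complex.real_smul]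
    ring
  simp only [smul_neg, integral_neg]
  rw [lhs, rhs, rhs]
  have E01 : ∫ z, pderiv 0 φ z • (((C z 1 : ℝ) : ℂ) * (conj (u z) * u z)) = _ := E 0 1
  have E10 : ∫ z, pderiv 1 φ z • (((C z 0 : ℝ) : ℂ) * (conj (u z) * u z)) = _ := E 1 0
  rw [E01, E10]
  linear_combination J

end Configuration

/-! ### Periodicity, integrability and the energy identity -/

section Energy

variable {L : Submodule ℤ Plane} {b : Module.Basis (Fin 2) ℤ L} {Ω : Set Plane} {u : Plane → ℂ}
  {a : Plane → Plane}

theorem potential_apply (a : Plane → Plane) (j : Fin 2) :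
    (fun z => (A0 + a) z j) = (A0form j : Plane → ℝ) + fun z => a z j := by
  funext z
  simp [A0_apply]

theorem memH1loc_potential (ha : ∀ j, MemH1loc (fun z => a z j)) (j : Fin 2) :
    MemH1loc (fun z => (A0 + a) z j) := by
  rw [potential_apply]
  exact (MemH1loc.of_contDiff (A0form j).contDiff).add (ha j)

theorem weakPartial_potential (ha : ∀ j, MemH1loc (fun z => a z j)) (i j : Fin 2) :
    ∀ᵐ z : Plane, weakPartial i (fun w => (A0 + a) w j) z =
      A0form j (EuclideanSpace.single i 1) + weakPartial i (fun w => a w j) z := by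
  rw [potential_apply]
  filter_upwards [((IsWeakPartial.of_contDiff (i := i) (A0form j).contDiff).add
    ((ha j).weakPartial_spec i).1).weakPartial_ae_eq] with z hz
  rw [hz]
  simp [pderiv]

theorem curl_potential (ha : ∀ j, MemH1loc (fun z => a z j)) :
    ∀ᵐ z : Plane, curl (A0 + a) z = 2 * Real.pi + curl a z := by
  filter_upwards [weakPartial_potential ha 0 1, weakPartial_potential ha 1 0] with z h1 h2
  rw [curl, h1, h2, curl]
  simp [A0form]
  ring

/-- Under a lattice translation the covariant derivatives of `u` pick up the multiplier of `u`,
and the curls are unchanged. -/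
theorem MemA.ae_translate (hua : MemA L b Ω u a) (k : Fin 2) : ∀ᵐ z : Plane,
    curl a (z + (b k : Plane)) = curl a z ∧
    curl (A0 + a) (z + (b k : Plane)) = curl (A0 + a) z ∧
    u (z + (b k : Plane)) = multiplier (b k) z * u z ∧
    ∀ i, covDeriv (A0 + a) u i (z + (b k : Plane)) =
      multiplier (b k) z * covDeriv (A0 + a) u i z := by
  set v : Plane := (b k : Plane) with hv
  have hu : ∀ᵐ z : Plane, u (z + v) = multiplier v z * u z := by
    filter_upwards [hua.u_section k] with z hz
    rw [hz, multiplier]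
    simp [phase, hv]
  have ha : ∀ᵐ z : Plane, a (z + v) = a z := hua.a_periodic v (b k).2
  have hda : ∀ i j, ∀ᵐ z : Plane,
      weakPartial i (fun w => a w j) (z + v) = weakPartial i (fun w => a w j) z := fun i j => by
    have h := ((hua.a_mem j).weakPartial_spec i).1
    exact ((h.comp_add_right v).congr (ha.mono fun z hz => congrArg (· j) hz) .rfl).ae_eq h
  have hdu : ∀ i, ∀ᵐ z : Plane, weakPartial i u (z + v) =
      multiplier v z * weakPartial i u z + pderiv i (multiplier v) z * u z := fun i => by
    have h := (hua.u_mem.weakPartial_spec i).1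
    exact ((h.comp_add_right v).congr hu .rfl).ae_eq (h.contDiff_mul (contDiff_multiplier v))
  have hC := curl_potential hua.a_mem
  filter_upwards [hu, ha, hda 0 1, hda 1 0, ae_all_iff.2 hdu, hC,
    (quasiMeasurePreserving_add v).ae hC] with z h1 h2 h3 h4 h5 h6 h7
  have hcurl : curl a (z + v) = curl a z := by simp only [curl, h3, h4]
  refine ⟨hcurl, by rw [h6, h7, hcurl], h1, fun i => ?_⟩
  have hA : (A0 + a) (z + v) i = (A0 + a) z i + A0 v i := by
    simp only [Pi.add_apply, PiLp.add_apply, A0_apply, map_add, h2]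
    ring
  simp only [covDeriv, h5, h1, hA, pderiv_multiplier, Complex.ofReal_add]
  ring

theorem norm_of_eq_multiplier_mul {v z : Plane} {x y : ℂ} (h : x = multiplier v z * y) :
    ‖x‖ = ‖y‖ := by
  rw [h, norm_mul, norm_multiplier, one_mul]

theorem conj_mul_of_eq_multiplier_mul {v z : Plane} {x y x' y' : ℂ} (h : x = multiplier v z * y)
    (h' : x' = multiplier v z * y') : conj x * x' = conj y * y' := by
  rw [h, h', map_mul]
  linear_combination conj y * y' * conj_multiplier_mul v z

theorem MemA.periodic_energyDensity (hua : MemA L b Ω u a) (k Hint : ℝ) (v : L) :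
    ∀ᵐ z : Plane, energyDensity k Hint u a (z + (v : Plane)) = energyDensity k Hint u a z := by
  refine ae_periodic_of_basis b (fun j => ?_) v
  filter_upwards [hua.ae_translate j] with z ⟨h1, _, h3, h4⟩
  simp only [energyDensity, norm_covGrad, h1, norm_of_eq_multiplier_mul h3,
    fun i => norm_of_eq_multiplier_mul (h4 i)]

theorem MemA.periodic_AplusDensity (hua : MemA L b Ω u a) (k Hint : ℝ) (v : L) :
    ∀ᵐ z : Plane, AplusDensity k Hint u a (z + (v : Plane)) = AplusDensity k Hint u a z := by
  refine ae_periodic_of_basis b (fun j => ?_) v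
  filter_upwards [hua.ae_translate j] with z ⟨_, h2, h3, h4⟩
  have h : Dplus (A0 + a) u (z + (b j : Plane)) =
      multiplier (b j) z * Dplus (A0 + a) u z := by
    simp only [Dplus_eq, h4]
    ring
  simp only [AplusDensity, h2, norm_of_eq_multiplier_mul h3, norm_of_eq_multiplier_mul h]

theorem MemA.periodic_currentCurl (hua : MemA L b Ω u a) (v : L) :
    ∀ᵐ z : Plane, currentCurl (A0 + a) u (z + (v : Plane)) = currentCurl (A0 + a) u z := by
  refine ae_periodic_of_basis b (fun j => ?_) v
  filter_upwards [hua.ae_translate j] with z ⟨_, h2, h3, h4⟩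
  simp only [currentCurl, h2, conj_mul_of_eq_multiplier_mul h3 h3,
    conj_mul_of_eq_multiplier_mul (h4 0) (h4 1), conj_mul_of_eq_multiplier_mul (h4 1) (h4 0)]

theorem MemA.periodic_current (hua : MemA L b Ω u a) (i : Fin 2) (v : L) :
    ∀ᵐ z : Plane, conj (u (z + (v : Plane))) * covDeriv (A0 + a) u i (z + (v : Plane)) =
      conj (u z) * covDeriv (A0 + a) u i z := by
  refine ae_periodic_of_basis b (f := fun z => conj (u z) * covDeriv (A0 + a) u i z)
    (fun j => ?_) v
  filter_upwards [hua.ae_translate j] with z ⟨_, _, h3, h4⟩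
  exact conj_mul_of_eq_multiplier_mul h3 (h4 i)

theorem MemA.periodic_curl (hua : MemA L b Ω u a) (v : L) :
    ∀ᵐ z : Plane, curl a (z + (v : Plane)) = curl a z :=
  ae_periodic_of_basis b (fun j => (hua.ae_translate j).mono fun _ h => h.1) v

theorem MemA.memL2loc_one_sub (hua : MemA L b Ω u a) :
    MemL2loc (fun z => 1 - ‖u z‖ ^ 2) := fun K hK => by
  refine (memL2loc_of_continuous continuous_const K hK).sub ?_
  refine (memLp_congr_ae (.of_forall fun z => ?_)).1 (memL2loc_normSq hua.u_mem K hK).norm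
  simp [sq]

theorem MemA.locallyIntegrable_energyDensity (hua : MemA L b Ω u a) (k Hint : ℝ) :
    LocallyIntegrable (energyDensity k Hint u a) volume := by
  have hD := memL2loc_covDeriv hua.u_mem (memH1loc_potential hua.a_mem)
  have h1 := ((hD 0).locallyIntegrable_norm_sq.add (hD 1).locallyIntegrable_norm_sq).smul
    (mu k Hint / 2)
  have h2 := hua.memL2loc_one_sub.locallyIntegrable_norm_sq.smul (1 / 4 : ℝ)
  have h3 := (memL2loc_curl hua.a_mem).locallyIntegrable_norm_sq.smul (mu k Hint ^ 2 * k ^ 2 / 2)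
  refine ((h1.add h2).add h3).congr_ae (.of_forall fun z => ?_)
  simp only [energyDensity, norm_covGrad, Fin.sum_univ_two, Pi.add_apply, Pi.smul_apply,
    smul_eq_mul, Real.norm_eq_abs, sq_abs]

theorem MemA.locallyIntegrable_AplusDensity (hua : MemA L b Ω u a) (k Hint : ℝ) :
    LocallyIntegrable (AplusDensity k Hint u a) volume := by
  have hD := memL2loc_covDeriv hua.u_mem (memH1loc_potential hua.a_mem)
  have hP : MemL2loc (Dplus (A0 + a) u) := fun K hK =>
    (memLp_congr_ae (.of_forall fun z => (Dplus_eq _ _ z).symm)).1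
      ((hD 0 K hK).add ((hD 1 K hK).const_mul Complex.I))
  have hQ : MemL2loc (fun z => mu k Hint * curl (A0 + a) z - (1 - ‖u z‖ ^ 2)) := fun K hK =>
    ((memL2loc_curl (memH1loc_potential hua.a_mem) K hK).const_mul _).sub
      (hua.memL2loc_one_sub K hK)
  refine ((hP.locallyIntegrable_norm_sq.smul (mu k Hint / 2)).add
    (hQ.locallyIntegrable_norm_sq.smul (1 / 4 : ℝ))).congr_ae (.of_forall fun z => ?_)
  simp [AplusDensity]

/-- The Bogomolny identity for the densities. -/
theorem MemA.ae_energyDensity_eq (hua : MemA L b Ω u a) (Hint : ℝ) : ∀ᵐ z : Plane,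
    energyDensity (1 / √2) Hint u a z = AplusDensity (1 / √2) Hint u a z +
      ((mu (1 / √2) Hint * Real.pi - (mu (1 / √2) Hint * Real.pi) ^ 2) +
      (mu (1 / √2) Hint / 2 * (currentCurl (A0 + a) u z).im +
      (mu (1 / √2) Hint / 2 - mu (1 / √2) Hint ^ 2 * Real.pi) * curl a z)) := by
  filter_upwards [curl_potential hua.a_mem] with z hz
  have hk : (1 / √2 : ℝ) ^ 2 = 1 / 2 := by rw [div_pow, Real.sq_sqrt zero_le_two, one_pow]
  simp only [energyDensity, AplusDensity, norm_covGrad, norm_Dplus_sq, hz, hk, sq_abs,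
    Fin.sum_univ_two]
  ring

variable [DiscreteTopology L] [IsZLattice ℝ L]

theorem MemA.setIntegral_currentCurl (hua : MemA L b Ω u a)
    (hΩ : IsAddFundamentalDomain L Ω volume) : ∫ z in Ω, currentCurl (A0 + a) u z = 0 := by
  have hC := memH1loc_potential hua.a_mem
  have hJ := locallyIntegrable_current hua.u_mem hC
  refine setIntegral_eq_zero_of_weak_divergence b hΩ (locallyIntegrable_currentCurl hua.u_mem hC)
    (hJ 1) (hJ 0).neg hua.periodic_currentCurl (hua.periodic_current 1) (fun v => ?_)
    fun φ hφ hc => integral_smul_currentCurl hua.u_mem hC hφ hc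
  filter_upwards [hua.periodic_current 0 v] with z hz
  simp only [Pi.neg_apply, hz]

theorem MemA.setIntegral_curl (hua : MemA L b Ω u a)
    (hΩ : IsAddFundamentalDomain L Ω volume) : ∫ z in Ω, curl a z = 0 := by
  have hp : ∀ i, ∀ v : L, ∀ᵐ z : Plane, a (z + (v : Plane)) i = a z i := fun i v =>
    (hua.a_periodic v v.2).mono fun z hz => congrArg (· i) hz
  have h01 := ((hua.a_mem 1).weakPartial_spec 0).1
  have h10 := ((hua.a_mem 0).weakPartial_spec 1).1
  refine setIntegral_eq_zero_of_weak_divergence b hΩ (g₀ := fun z => a z 1)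
    (g₁ := fun z => -(a z 0)) (memL2loc_curl hua.a_mem).locallyIntegrable h01.1 h10.1.neg
    hua.periodic_curl (hp 1) (fun v => (hp 0 v).mono fun z hz => by rw [hz]) fun φ hφ hc => ?_
  have e1 := h01.2.2 φ hφ hc
  have e2 := h10.2.2 φ hφ hc
  simp only [smul_neg, integral_neg, pderiv]
  rw [e1, e2]
  simp only [curl, smul_sub]
  rw [integral_sub (h01.2.1.integrable_smul_left_of_hasCompactSupport hφ.continuous hc)
    (h10.2.1.integrable_smul_left_of_hasCompactSupport hφ.continuous hc)]
  ring

end Energy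

end GinzburgLandau

theorem theorem3 (L : Submodule ℤ GinzburgLandau.Plane) [DiscreteTopology L] [IsZLattice ℝ L]
    (b : Module.Basis (Fin 2) ℤ L) (Ω : Set GinzburgLandau.Plane)
    (hΩ : IsAddFundamentalDomain L Ω volume) (hvol : volume Ω = 1) (Hint : ℝ)
    (u : GinzburgLandau.Plane → ℂ) (a : GinzburgLandau.Plane → GinzburgLandau.Plane)
    (hua : GinzburgLandau.MemA L b Ω u a) :
    IntegrableOn (GinzburgLandau.energyDensity (1 / √2) Hint u a) Ω volume ∧
    IntegrableOn (GinzburgLandau.AplusDensity (1 / √2) Hint u a) Ω volume ∧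
    GinzburgLandau.energy Ω (1 / √2) Hint u a =
      GinzburgLandau.mu (1 / √2) Hint * Real.pi
        - (GinzburgLandau.mu (1 / √2) Hint * Real.pi) ^ 2
        + GinzburgLandau.Aplus Ω (1 / √2) Hint u a := by
  have hE := GinzburgLandau.integrableOn_of_periodic b hΩ
    (hua.locallyIntegrable_energyDensity (1 / √2) Hint) (hua.periodic_energyDensity _ _)
  have hA := GinzburgLandau.integrableOn_of_periodic b hΩ
    (hua.locallyIntegrable_AplusDensity (1 / √2) Hint) (hua.periodic_AplusDensity _ _)
  refine ⟨hE, hA, ?_⟩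
  have hG := GinzburgLandau.integrableOn_of_periodic b hΩ
    (GinzburgLandau.locallyIntegrable_currentCurl hua.u_mem
      (GinzburgLandau.memH1loc_potential hua.a_mem)) hua.periodic_currentCurl
  have hGi : IntegrableOn (fun z => (GinzburgLandau.currentCurl (GinzburgLandau.A0 + a) u z).im) Ω
    volume := hG.im
  have hG0 : ∫ z in Ω, (GinzburgLandau.currentCurl (GinzburgLandau.A0 + a) u z).im = 0 := by
    have := Complex.imCLM.integral_comp_comm hG
    simpa [hua.setIntegral_currentCurl hΩ] using this
  have hc := GinzburgLandau.integrableOn_of_periodic b hΩ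
    (GinzburgLandau.memL2loc_curl hua.a_mem).locallyIntegrable hua.periodic_curl
  have hfin : IsFiniteMeasure (volume.restrict Ω) := ⟨by simp [hvol]⟩
  rw [GinzburgLandau.energy, GinzburgLandau.Aplus,
    integral_congr_ae (ae_restrict_of_ae (hua.ae_energyDensity_eq Hint))]
  generalize GinzburgLandau.mu (1 / √2) Hint = m
  have i1 : IntegrableOn (fun z =>
      m / 2 * (GinzburgLandau.currentCurl (GinzburgLandau.A0 + a) u z).im +
        (m / 2 - m ^ 2 * Real.pi) * GinzburgLandau.curl a z) Ω volume :=
    (hGi.const_mul _).add (hc.const_mul _)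
  have i2 : IntegrableOn (fun z => (m * Real.pi - (m * Real.pi) ^ 2) +
      (m / 2 * (GinzburgLandau.currentCurl (GinzburgLandau.A0 + a) u z).im +
        (m / 2 - m ^ 2 * Real.pi) * GinzburgLandau.curl a z)) Ω volume :=
    (integrable_const _).add i1
  rw [integral_add hA i2, integral_add (integrable_const _) i1,
    integral_add (hGi.const_mul _) (hc.const_mul _), integral_const_mul, integral_const_mul, hG0,
    hua.setIntegral_curl hΩ]
  simp [Measure.real, hvol]
  ring
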